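/- Let $K$ run over the cyclic cubic extensions of $\mathbb{Q}$ up to isomorphism. Let $f(K)$ denote the conductor of $K$, that is, the least positive integer $n$ such that $K$ embeds into $\mathbb{Q}(\zeta_n)$; such an $n$ exists for every $K$. Then for every $s\in\mathbb{C}$ with $\Re(s)>1$ the following series and product converge absolutely and $$\sum_{K/\mathbb{Q}\text{ cyclic cubic}}\frac{1}{f(K)^s}=-\frac12+\frac12\left(1+\frac{2}{3^{2s}}\right)\prod_{p\equiv1\ (\mathrm{mod}\ 3)}\left(1+\frac{2}{p^s}\right),$$ where $p$ runs over primes. Moreover, for every real $X$ the number $M(\mathbb{Q},X)$ of cyclic cubic fields $K$, up to isomorphism, with $f(K)\le X$ is finite, and for every $\varepsilon>0$, as $X\to\infty$, $$M(\mathbb{Q},X)=C(\mathbb{Q})\,X+O_\varepsilon\!\left(X^{2/3+\varepsilon}\right),\qquad C(\mathbb{Q})=\frac{11\sqrt3}{36\pi}\prod_{p\equiv1\ (\mathrm{mod}\ 3)}\left(1-\frac{2}{p(p+1)}\right),$$ where the product converges. -/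

import Mathlib

namespace CyclicCubic

/-- `F` is a cyclic cubic extension of `ℚ`: Galois of degree `3` with cyclic Galois group. -/
structure IsCyclicCubic (F : Type*) [Field F] [Algebra ℚ F] : Prop where
  finrank_eq : Module.finrank ℚ F = 3
  isGalois : IsGalois ℚ F
  isCyclic : IsCyclic (F ≃ₐ[ℚ] F)

/-- `F` embeds into the `n`-th cyclotomic field, which is the ray class field of `ℚ` for the
modulus `n∞`. -/
def EmbedsInCyclotomic (F : Type*) [Field F] [Algebra ℚ F] (n : ℕ) : Prop :=
  0 < n ∧ Nonempty (F →ₐ[ℚ] CyclotomicField n ℚ)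

/-- The conductor `f(F)` of an abelian number field `F`: the least positive `n` such that `F`
embeds into `ℚ(ζₙ)`. -/
noncomputable def conductor (F : Type*) [Field F] [Algebra ℚ F] : ℕ :=
  sInf {n : ℕ | EmbedsInCyclotomic F n}

/-- The set of cyclic cubic fields up to isomorphism, each represented by its copy inside a fixed
algebraic closure of `ℚ`; `existsUnique_cyclicCubicField` below shows that every isomorphism class
is represented exactly once. -/
abbrev CyclicCubicField : Type :=
  {K : IntermediateField ℚ (AlgebraicClosure ℚ) // IsCyclicCubic K}

theorem IsCyclicCubic.of_algEquiv {F E : Type*} [Field F] [Algebra ℚ F] [Field E] [Algebra ℚ E]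
    (h : IsCyclicCubic F) (e : F ≃ₐ[ℚ] E) : IsCyclicCubic E where
  finrank_eq := by rw [← e.toLinearEquiv.finrank_eq, h.finrank_eq]
  isGalois := by
    have := h.isGalois
    exact IsGalois.of_algEquiv e
  isCyclic := by
    have := h.isCyclic
    exact isCyclic_of_surjective e.autCongr.toMonoidHom e.autCongr.surjective

theorem existsUnique_cyclicCubicField (F : Type*) [Field F] [Algebra ℚ F]
    (h : IsCyclicCubic F) : ∃! K : CyclicCubicField, Nonempty (F ≃ₐ[ℚ] K.1) := by
  have := h.isGalois
  have : FiniteDimensional ℚ F := Module.finite_of_finrank_eq_succ h.finrank_eq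
  let i : F →ₐ[ℚ] AlgebraicClosure ℚ := IsAlgClosed.lift
  have e : F ≃ₐ[ℚ] i.fieldRange := AlgEquiv.ofInjectiveField i
  refine ⟨⟨i.fieldRange, h.of_algEquiv e⟩, ⟨e⟩, ?_⟩
  rintro ⟨K, hK⟩ ⟨e'⟩
  have hG : IsGalois ℚ i.fieldRange := (h.of_algEquiv e).isGalois
  -- all `ℚ`-algebra structures on a field agree
  have : @Normal ℚ i.fieldRange _ _ i.fieldRange.algebra' := by
    convert hG.to_normal
    exact Subsingleton.elim _ _
  have h1 := AlgHom.fieldRange_of_normal (E := i.fieldRange)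
    (K.val.comp (e.symm.trans e').toAlgHom)
  apply Subtype.ext
  change K = i.fieldRange
  rw [← h1]
  ext x
  constructor
  · intro hx
    refine ⟨(e.symm.trans e').symm ⟨x, hx⟩, ?_⟩
    exact congrArg K.val ((e.symm.trans e').apply_symm_apply ⟨x, hx⟩)
  · rintro ⟨y, rfl⟩
    exact ((e.symm.trans e') y).2

/-- The primes `p ≡ 1 (mod 3)`. -/
abbrev PrimeOneModThree : Type := {p : ℕ // p.Prime ∧ p % 3 = 1}

/-- `M(ℚ, X)`, the number of cyclic cubic fields up to isomorphism with conductor at most `X`. -/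
noncomputable def countingFunction (X : ℝ) : ℕ :=
  Set.ncard {K : CyclicCubicField | (conductor K.1 : ℝ) ≤ X}

/-- The constant `C(ℚ) = 11√3/(36π) · ∏_{p ≡ 1 (mod 3)} (1 - 2/(p(p+1)))`. -/
noncomputable def leadingConstant : ℝ :=
  11 * Real.sqrt 3 / (36 * Real.pi) *
    ∏' p : PrimeOneModThree, (1 - 2 / ((p.1 : ℝ) * ((p.1 : ℝ) + 1)))

end CyclicCubic

namespace CyclicCubic

open IntermediateField

/-! ### Subgroups of order three in a finite abelian group -/

section Group

/-! Counting cyclic cubic fields amounts to counting cubic characters. Cubic subfields of ℚ(ζₙ)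
correspond to order-3 subgroups of the group of Dirichlet characters mod n, which is isomorphic to
(ℤ/n)ˣ. Each such subgroup contains two characters of order 3, so twice the number of cubic
subfields, plus one, is #(ℤ/n)ˣ[3] (`card_cubic_le_cyclo`). Because ℚ(ζₘ) ∩ ℚ(ζₙ) = ℚ(ζ_gcd), K lies
in ℚ(ζₙ) iff f(K) ∣ n. Möbius inversion then shows that h(n) = 2·#{K : f(K) = n} + [n = 1] is
multiplicative (`charFun_eq`). At prime powers p^k with k ≥ 1 it is 2 at the primes p ≡ 1 mod 3 and
at 9, and 0 otherwise. The Euler product of ∑ h(n)n⁻ˢ is the series formula.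

That each cyclic cubic field is cyclotomic is proved directly (`le_cycloUnion`). For an integer of K
with Lagrange resolvents R, S, the cubes R³ = a and S³ = ā lie in ℤ[ω] and RS is an integer, so
(RS·S)³ = aā². It suffices that every aā² is a cube in the union of the cyclotomic fields. This is
multiplicative in a and ℤ[ω] factors uniquely, so only units and primes matter. The one deep case is
p ≡ 1 mod 3, where the Gauss sum of a cubic character has cube pJ = J²J̄, with J a Jacobi sum and
JJ̄ = p.

For the asymptotics write h = q * (χ * 1), with χ the nontrivial character mod 3. The quotient q
vanishes at every prime but 3, so ∑ |q(d)|d^(-2/3) converges, while χ * 1 has summatory function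
L(1,χ)x + O(x^(2/3)) with L(1,χ) = π/(3√3). Summing over d gives the main term with constant
L(1,χ)·∑ q(d)/d (`abs_sum_charFun_sub_le`); the last series is an Euler product evaluated through
ζ(2) (`tsum_quotFun_div`). -/

theorem two_mul_ncard_subgroup_card_three_add_one (G : Type*) [CommGroup G] [Finite G] :
    2 * {Y : Subgroup G | Nat.card Y = 3}.ncard + 1 = Nat.card {u : G // u ^ 3 = 1} := by
  classical
  have := Fintype.ofFinite G
  have := Fintype.ofFinite (Subgroup G)
  have hp : Fact (Nat.Prime 3) := ⟨Nat.prime_three⟩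
  set S : Finset (Subgroup G) := Finset.univ.filter fun Y => Nat.card Y = 3 with hS
  set T : Finset G := Finset.univ.filter fun u => orderOf u = 3 with hT
  have h1 : {Y : Subgroup G | Nat.card Y = 3}.ncard = S.card := by
    rw [← Set.ncard_coe_finset]
    congr 1
    ext
    simp [hS]
  have h2 : T.card = S.card * 2 := by
    have hm : ∀ u ∈ T, Subgroup.zpowers u ∈ S := fun u hu => by
      simp only [hS, hT, Finset.mem_filter, Finset.mem_univ, true_and, Nat.card_zpowers] at hu ⊢
      exact hu
    rw [Finset.card_eq_sum_card_fiberwise hm, Finset.sum_const_nat]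
    intro Y hY
    have hY : Nat.card Y = 3 := by simpa [hS] using hY
    -- The generators of a group of order 3 are its two nonidentity elements.
    have hfib : T.filter (fun u => Subgroup.zpowers u = Y) = (Y : Set G).toFinset.erase 1 := by
      ext u
      simp only [hT, Finset.mem_filter, Finset.mem_univ, true_and, Finset.mem_erase,
        Set.mem_toFinset, SetLike.mem_coe]
      constructor
      · rintro ⟨h, rfl⟩
        refine ⟨?_, Subgroup.mem_zpowers u⟩
        rintro rfl
        simp at h
      · rintro ⟨h, hu⟩
        have h3 : u ^ 3 = 1 := by
          have := pow_card_eq_one' (x := (⟨u, hu⟩ : Y))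
          rw [hY] at this
          exact congrArg Subtype.val this
        have ho := orderOf_eq_prime h3 h
        refine ⟨ho, Subgroup.eq_of_le_of_card_ge (by simpa using hu) ?_⟩
        rw [hY, Nat.card_zpowers, ho]
    rw [hfib, Finset.card_erase_of_mem (by simp [Y.one_mem]), Set.toFinset_card,
      ← Nat.card_eq_fintype_card]
    change Nat.card Y - 1 = 2
    rw [hY]
  have h3 : Nat.card {u : G // u ^ 3 = 1} = T.card + 1 := by
    rw [Nat.card_eq_fintype_card, Fintype.card_subtype]
    have : (Finset.univ.filter fun u : G => u ^ 3 = 1) = insert 1 T := by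
      ext u
      simp only [Finset.mem_filter, Finset.mem_univ, true_and, Finset.mem_insert, hT]
      by_cases hu : u = 1
      · simp [hu]
      · simp only [hu, false_or]
        exact ⟨fun h => orderOf_eq_prime h hu, fun h => h ▸ pow_orderOf_eq_one u⟩
    rw [this, Finset.card_insert_of_notMem (by simp [hT])]
  rw [h1, h3, h2, mul_comm]

end Group

/-! ### Subfields of cyclotomic fields through Dirichlet characters -/

section Characters

variable {n : ℕ} [NeZero n] {E : Type*} [Field E] [NumberField E] [IsCyclotomicExtension {n} ℚ E]

open IsCyclotomicExtension.Rat in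
-- Lying in ℚ(ζₖ) means that all characters of F have conductor dividing k; a conductor dividing
-- both k and l divides their gcd.
theorem le_of_le_of_le_of_isCyclotomicExtension {k l : ℕ} (hk : k ∣ n) (hl : l ∣ n)
    {F F₁ F₂ F₃ : IntermediateField ℚ E} [IsCyclotomicExtension {k} ℚ F₁]
    [IsCyclotomicExtension {l} ℚ F₂] [IsCyclotomicExtension {k.gcd l} ℚ F₃]
    (h₁ : F ≤ F₁) (h₂ : F ≤ F₂) : F ≤ F₃ := by
  have := IsCyclotomicExtension.isAbelianGalois {n} ℚ E
  have : NeZero k := ⟨fun h => NeZero.ne n (by simpa [h] using hk)⟩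
  have : NeZero l := ⟨fun h => NeZero.ne n (by simpa [h] using hl)⟩
  have : NeZero (k.gcd l) := ⟨Nat.gcd_ne_zero_left (NeZero.ne k)⟩
  have := IsCyclotomicExtension.isGalois {k} ℚ F₁
  have := IsCyclotomicExtension.isGalois {l} ℚ F₂
  have := IsCyclotomicExtension.isGalois {k.gcd l} ℚ F₃
  let Φ := intermediateFieldEquivSubgroupChar n E ℂ
  rw [← Φ.le_iff_le] at h₁ h₂ ⊢
  intro χ hχ
  exact (mem_intermediateFieldEquivSubgroupChar_iff_conductor_dvd n E ℂ F₃
    ((Nat.gcd_dvd_left k l).trans hk) χ).2 (Nat.dvd_gcd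
    ((mem_intermediateFieldEquivSubgroupChar_iff_conductor_dvd n E ℂ F₁ hk χ).1 (h₁ hχ))
    ((mem_intermediateFieldEquivSubgroupChar_iff_conductor_dvd n E ℂ F₂ hl χ).1 (h₂ hχ)))

variable (n E) in
open IsCyclotomicExtension.Rat in
theorem two_mul_ncard_finrank_three_add_one :
    {F : IntermediateField ℚ E | Module.finrank ℚ F = 3}.Finite ∧
    2 * {F : IntermediateField ℚ E | Module.finrank ℚ F = 3}.ncard + 1 =
      Nat.card {u : (ZMod n)ˣ // u ^ 3 = 1} := by
  have := IsCyclotomicExtension.isAbelianGalois {n} ℚ E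
  let Φ := intermediateFieldEquivSubgroupChar n E ℂ
  have h : Φ '' {F : IntermediateField ℚ E | Module.finrank ℚ F = 3} =
      {Y : Subgroup (DirichletCharacter ℂ n) | Nat.card Y = 3} := by
    ext Y
    obtain ⟨F, rfl⟩ := Φ.surjective Y
    rw [Φ.injective.mem_set_image]
    simp only [Set.mem_ofPred_eq]
    rw [← card_intermediateFieldEquivSubgroupChar n E ℂ F]
  refine ⟨Set.Finite.of_finite_image (f := Φ) (Set.toFinite _) Φ.injective.injOn, ?_⟩
  rw [← Set.ncard_image_of_injective _ Φ.injective, h, two_mul_ncard_subgroup_card_three_add_one]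
  obtain ⟨e⟩ := MulChar.mulEquiv_units (ZMod n) ℂ
  exact Nat.card_congr (e.toEquiv.subtypeEquiv fun u => by simp [← map_pow])

end Characters

/-! ### Cyclotomic fields inside an algebraically closed field -/

section Fields

variable (Ω : Type*) [Field Ω] [Algebra ℚ Ω]

/-- Inside this section the algebra structure of an intermediate field is the inherited one. -/
local instance (priority := 2000) inheritedAlgebra {L : Type*} [Field L] [Algebra ℚ L]
    (K : IntermediateField ℚ L) : Algebra ℚ K := K.algebra'

/-- The field `ℚ(ζₙ)` inside an algebraic closure of `ℚ`. -/
def cyclo (n : ℕ) : IntermediateField ℚ Ω :=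
  IntermediateField.adjoin ℚ {b | ∃ k ∈ ({n} : Set ℕ), k ≠ 0 ∧ b ^ k = 1}

variable {Ω}

theorem isCyclotomicExtension_cyclo_of_isPrimitiveRoot {n : ℕ} {ζ : Ω} (h : IsPrimitiveRoot ζ n) :
    IsCyclotomicExtension {n} ℚ (cyclo Ω n) := by
  refine IntermediateField.isCyclotomicExtension_adjoin_of_exists_isPrimitiveRoot {n} ℚ Ω ?_
  rintro k rfl hk
  exact ⟨ζ, h⟩

theorem mem_cyclo_of_pow_eq_one {n : ℕ} (hn : n ≠ 0) {x : Ω} (h : x ^ n = 1) : x ∈ cyclo Ω n :=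
  IntermediateField.subset_adjoin _ _ ⟨n, rfl, hn, h⟩

variable [IsAlgClosed Ω]

variable (Ω) in
theorem exists_isPrimitiveRoot (n : ℕ) [NeZero n] : ∃ ζ : Ω, IsPrimitiveRoot ζ n := by
  have := algebraRat.charZero Ω
  exact HasEnoughRootsOfUnity.exists_primitiveRoot _ n

instance isCyclotomicExtension_cyclo (n : ℕ) : IsCyclotomicExtension {n} ℚ (cyclo Ω n) := by
  refine IntermediateField.isCyclotomicExtension_adjoin_of_exists_isPrimitiveRoot {n} ℚ Ω ?_
  rintro k - hk
  have : NeZero k := ⟨hk⟩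
  exact exists_isPrimitiveRoot Ω k

theorem cyclo_le_of_dvd {m n : ℕ} (hn : n ≠ 0) (h : m ∣ n) : cyclo Ω m ≤ cyclo Ω n := by
  have : NeZero n := ⟨hn⟩
  exact IntermediateField.isCyclotomicExtension_le_of_dvd _ _ m n (cyclo Ω m) (cyclo Ω n) h

theorem fieldRange_eq_cyclo {n : ℕ} {E : Type*} [Field E] [Algebra ℚ E]
    [IsCyclotomicExtension {n} ℚ E] (φ : E →ₐ[ℚ] Ω) : φ.fieldRange = cyclo Ω n := by
  have : IsCyclotomicExtension {n} ℚ φ.fieldRange :=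
    IsCyclotomicExtension.equiv {n} ℚ E (AlgEquiv.ofInjectiveField φ)
  exact IntermediateField.isCyclotomicExtension_eq {n} _ _ _ _

/-- Since K is normal, every embedding of K into Ω has image K, so abstract embeddability becomes
containment. -/
theorem nonempty_algHom_iff_le_cyclo (K : IntermediateField ℚ Ω) [IsGalois ℚ K] (n : ℕ)
    (E : Type*) [Field E] [Algebra ℚ E] [IsCyclotomicExtension {n} ℚ E] :
    Nonempty (K →ₐ[ℚ] E) ↔ K ≤ cyclo Ω n := by
  have := IsCyclotomicExtension.integral {n} ℚ E
  let φ : E →ₐ[ℚ] Ω := IsAlgClosed.lift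
  rw [← fieldRange_eq_cyclo (n := n) φ]
  refine ⟨?_, fun h => ?_⟩
  · rintro ⟨f⟩
    rw [← AlgHom.fieldRange_of_normal (φ.comp f)]
    rintro x ⟨y, rfl⟩
    exact ⟨f y, rfl⟩
  · let e : E ≃ₐ[ℚ] φ.fieldRange := AlgEquiv.ofInjectiveField φ
    exact ⟨(e.symm : φ.fieldRange →ₐ[ℚ] E).comp (IntermediateField.inclusion h)⟩

theorem isAbelianGalois_of_le_cyclo {n : ℕ} {K : IntermediateField ℚ Ω} (h : K ≤ cyclo Ω n) :
    IsAbelianGalois ℚ K := by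
  have := IsCyclotomicExtension.isAbelianGalois {n} ℚ (cyclo Ω n)
  exact .of_algHom (IntermediateField.inclusion h)

theorem isCyclicCubic_iff_of_le_cyclo {n : ℕ} {K : IntermediateField ℚ Ω} (h : K ≤ cyclo Ω n) :
    IsCyclicCubic K ↔ Module.finrank ℚ K = 3 := by
  refine ⟨fun h => h.finrank_eq, fun h3 => ?_⟩
  have := isAbelianGalois_of_le_cyclo h
  have : FiniteDimensional ℚ K := Module.finite_of_finrank_eq_succ h3
  have : Fact (Nat.Prime 3) := ⟨Nat.prime_three⟩
  exact ⟨h3, inferInstance,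
    isCyclic_of_prime_card (p := 3) (by rw [IsGalois.card_aut_eq_finrank, h3])⟩

theorem map_cyclo {n m : ℕ} [NeZero n] {E : Type*} [Field E] [Algebra ℚ E]
    [IsCyclotomicExtension {n} ℚ E] (h : m ∣ n) (φ : E →ₐ[ℚ] Ω) :
    IsCyclotomicExtension {m} ℚ (cyclo E m) ∧ (cyclo E m).map φ = cyclo Ω m := by
  have h1 : IsCyclotomicExtension {m} ℚ (cyclo E m) := by
    obtain ⟨k, rfl⟩ := h
    have hζ := IsCyclotomicExtension.zeta_spec (m * k) ℚ E
    exact isCyclotomicExtension_cyclo_of_isPrimitiveRoot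
      (hζ.pow (Nat.pos_of_ne_zero (NeZero.ne _)) (mul_comm m k))
  refine ⟨h1, ?_⟩
  rw [← fieldRange_eq_cyclo (φ.comp (cyclo E m).val), AlgHom.fieldRange_eq_map,
    ← IntermediateField.map_map, ← AlgHom.fieldRange_eq_map, IntermediateField.fieldRange_val]

theorem le_of_map_le_map {E L : Type*} [Field E] [Algebra ℚ E] [Field L] [Algebra ℚ L]
    (φ : E →ₐ[ℚ] L) {F G : IntermediateField ℚ E} (h : F.map φ ≤ G.map φ) : F ≤ G := by
  intro x hx
  obtain ⟨y, hy, e⟩ := h ⟨x, hx, rfl⟩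
  exact φ.injective e ▸ hy

/-- Pulled back to ℚ(ζ_lcm), which contains both fields, the claim becomes the character argument
for gcds. -/
theorem le_cyclo_gcd {m n : ℕ} (hm : m ≠ 0) (hn : n ≠ 0) {K : IntermediateField ℚ Ω}
    (h1 : K ≤ cyclo Ω m) (h2 : K ≤ cyclo Ω n) : K ≤ cyclo Ω (m.gcd n) := by
  have : NeZero (m.lcm n) := ⟨Nat.lcm_ne_zero hm hn⟩
  let E := CyclotomicField (m.lcm n) ℚ
  have : IsCyclotomicExtension {m.lcm n} ℚ E := CyclotomicField.isCyclotomicExtension _ ℚ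
  have := IsCyclotomicExtension.integral {m.lcm n} ℚ E
  let φ : E →ₐ[ℚ] Ω := IsAlgClosed.lift
  have hg : m.gcd n ∣ m.lcm n := (Nat.gcd_dvd_left m n).trans (Nat.dvd_lcm_left m n)
  obtain ⟨i1, e1⟩ := map_cyclo (Nat.dvd_lcm_left m n) φ
  obtain ⟨i2, e2⟩ := map_cyclo (Nat.dvd_lcm_right m n) φ
  obtain ⟨i3, e3⟩ := map_cyclo hg φ
  have hK : K ≤ φ.fieldRange := by
    rw [fieldRange_eq_cyclo (n := m.lcm n) φ]
    exact h1.trans (cyclo_le_of_dvd (NeZero.ne _) (Nat.dvd_lcm_left m n))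
  obtain ⟨F, rfl⟩ : ∃ F : IntermediateField ℚ E, F.map φ = K :=
    ⟨K.comap φ, IntermediateField.map_comap_eq_self hK⟩
  replace h1 : F ≤ _ := le_of_map_le_map φ (h1.trans e1.ge)
  replace h2 : F ≤ _ := le_of_map_le_map φ (h2.trans e2.ge)
  refine le_trans (IntermediateField.map_mono φ ?_) e3.le
  have : NumberField E := inferInstance
  exact @le_of_le_of_le_of_isCyclotomicExtension (m.lcm n) _ E _ _ _ m n (Nat.dvd_lcm_left m n)
    (Nat.dvd_lcm_right m n) F _ _ _ i1 i2 i3 h1 h2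

theorem card_cubic_le_cyclo (n : ℕ) [NeZero n] :
    {K : IntermediateField ℚ Ω | K ≤ cyclo Ω n ∧ IsCyclicCubic K}.Finite ∧
    2 * {K : IntermediateField ℚ Ω | K ≤ cyclo Ω n ∧ IsCyclicCubic K}.ncard + 1 =
      Nat.card {u : (ZMod n)ˣ // u ^ 3 = 1} := by
  let E := CyclotomicField n ℚ
  have : IsCyclotomicExtension {n} ℚ E := CyclotomicField.isCyclotomicExtension _ ℚ
  have := IsCyclotomicExtension.integral {n} ℚ E
  let φ : E →ₐ[ℚ] Ω := IsAlgClosed.lift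
  have himg : {K : IntermediateField ℚ Ω | K ≤ cyclo Ω n ∧ IsCyclicCubic K} =
      IntermediateField.map φ '' {F : IntermediateField ℚ E | Module.finrank ℚ F = 3} := by
    ext K
    constructor
    · rintro ⟨h1, h2⟩
      obtain ⟨F, rfl⟩ : ∃ F : IntermediateField ℚ E, F.map φ = K :=
        ⟨K.comap φ, IntermediateField.map_comap_eq_self (by rwa [fieldRange_eq_cyclo (n := n) φ])⟩
      refine ⟨F, ?_, rfl⟩
      rw [← h2.finrank_eq]
      exact (F.equivMap φ).toLinearEquiv.finrank_eq
    · rintro ⟨F, hF, rfl⟩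
      have h : F.map φ ≤ cyclo Ω n := by
        rw [← fieldRange_eq_cyclo (n := n) φ, AlgHom.fieldRange_eq_map]
        exact IntermediateField.map_mono φ le_top
      refine ⟨h, (isCyclicCubic_iff_of_le_cyclo h).2 ?_⟩
      rw [← hF]
      exact (F.equivMap φ).toLinearEquiv.finrank_eq.symm
  obtain ⟨h1, h2⟩ := two_mul_ncard_finrank_three_add_one n E
  rw [himg, Set.ncard_image_of_injective _ (IntermediateField.map_injective φ)]
  exact ⟨h1.image _, h2⟩

end Fields


/-! ### The union of the cyclotomic fields -/

section AbelianClosure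

attribute [local instance] inheritedAlgebra

variable (Ω : Type*) [Field Ω] [Algebra ℚ Ω] [IsAlgClosed Ω]

/-- The union of all cyclotomic fields `ℚ(ζₙ)` inside an algebraic closure of `ℚ`. -/
def cycloUnion : IntermediateField ℚ Ω where
  carrier := {x | ∃ n : ℕ, n ≠ 0 ∧ x ∈ cyclo Ω n}
  mul_mem' := by
    rintro x y ⟨m, hm, hx⟩ ⟨n, hn, hy⟩
    have h := mul_ne_zero hm hn
    exact ⟨m * n, h, mul_mem (cyclo_le_of_dvd h (dvd_mul_right m n) hx)
      (cyclo_le_of_dvd h (dvd_mul_left n m) hy)⟩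
  add_mem' := by
    rintro x y ⟨m, hm, hx⟩ ⟨n, hn, hy⟩
    have h := mul_ne_zero hm hn
    exact ⟨m * n, h, add_mem (cyclo_le_of_dvd h (dvd_mul_right m n) hx)
      (cyclo_le_of_dvd h (dvd_mul_left n m) hy)⟩
  algebraMap_mem' := fun r => ⟨1, one_ne_zero, (cyclo Ω 1).algebraMap_mem r⟩
  inv_mem' := by
    rintro x ⟨m, hm, hx⟩
    exact ⟨m, hm, inv_mem hx⟩

variable {Ω}

theorem mem_cycloUnion_of_pow_eq_one {n : ℕ} (hn : n ≠ 0) {x : Ω} (h : x ^ n = 1) :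
    x ∈ cycloUnion Ω := ⟨n, hn, mem_cyclo_of_pow_eq_one hn h⟩

theorem mem_cycloUnion_of_pow_three_eq {x y : Ω} (hx : x ∈ cycloUnion Ω) (h : y ^ 3 = x ^ 3) :
    y ∈ cycloUnion Ω := by
  by_cases h0 : x = 0
  · subst h0
    have : y = 0 := by simpa using h
    rwa [this]
  · have h1 : (y / x) ^ 3 = 1 := by rw [div_pow, h, div_self (pow_ne_zero 3 h0)]
    rw [← div_mul_cancel₀ y h0]
    exact mul_mem (mem_cycloUnion_of_pow_eq_one three_ne_zero h1) hx

theorem exists_le_cyclo_of_le_cycloUnion {K : IntermediateField ℚ Ω}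
    (hK : Module.finrank ℚ K ≠ 0)
    (h : K ≤ cycloUnion Ω) : ∃ n : ℕ, n ≠ 0 ∧ K ≤ cyclo Ω n := by
  have : FiniteDimensional ℚ K := Module.finite_of_finrank_pos (Nat.pos_of_ne_zero hK)
  obtain ⟨θ, hθ⟩ := Field.exists_primitive_element ℚ K
  obtain ⟨n, hn, hmem⟩ := h θ.2
  refine ⟨n, hn, ?_⟩
  have h1 : (ℚ⟮θ⟯).map K.val = K := by
    rw [hθ, ← AlgHom.fieldRange_eq_map, IntermediateField.fieldRange_val]
  rw [← h1, IntermediateField.adjoin_map, IntermediateField.adjoin_le_iff]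
  simpa using hmem

end AbelianClosure

/-! ### Eisenstein integers and cubes of twists -/

section Eisenstein

/-- `O` is a copy of the ring of Eisenstein integers: it is generated over `ℤ` by the cube root of
unity `η`, and `c` is its conjugation. -/
structure IsEisenstein {O : Type*} [CommRing O] (η : O) (c : O →+* O) : Prop where
  root : η ^ 2 + η + 1 = 0
  span : ∀ x : O, ∃ a b : ℤ, x = a + b * η
  conj : c η = η ^ 2

variable {O : Type*} [CommRing O] {η : O} {c : O →+* O}

namespace IsEisenstein

theorem pow_three (h : IsEisenstein η c) : η ^ 3 = 1 := by
  linear_combination (η - 1) * h.root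

theorem conj_conj (h : IsEisenstein η c) (x : O) : c (c x) = x := by
  obtain ⟨a, b, rfl⟩ := h.span x
  simp only [map_add, map_mul, map_intCast, h.conj, map_pow]
  linear_combination b * η * h.pow_three

theorem exists_norm (h : IsEisenstein η c) (x : O) :
    ∃ a b : ℤ, x * c x = ((a ^ 2 - a * b + b ^ 2 : ℤ) : O) := by
  obtain ⟨a, b, rfl⟩ := h.span x
  refine ⟨a, b, ?_⟩
  simp only [map_add, map_mul, map_intCast, h.conj]
  push_cast
  linear_combination b ^ 2 * h.pow_three + a * b * h.root

/-- The norm of an Eisenstein integer. -/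
theorem exists_nat_norm (h : IsEisenstein η c) (x : O) :
    ∃ n : ℕ, x * c x = n ∧ n % 3 ≠ 2 := by
  obtain ⟨a, b, hab⟩ := h.exists_norm x
  have h0 : 0 ≤ a ^ 2 - a * b + b ^ 2 := by nlinarith [sq_nonneg (a - b), sq_nonneg a, sq_nonneg b]
  refine ⟨(a ^ 2 - a * b + b ^ 2).toNat, ?_, ?_⟩
  · rw [hab, ← Int.cast_natCast (R := O), Int.toNat_of_nonneg h0]
  · intro h2
    have h3 : (a ^ 2 - a * b + b ^ 2) % 3 = 2 := by omega
    have h4 : (a ^ 2 - a * b + b ^ 2) % 3 =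
        (((a % 3) ^ 2 - (a % 3) * (b % 3) + (b % 3) ^ 2)) % 3 := by
      simp [Int.sub_emod, Int.add_emod, Int.mul_emod, pow_two]
    -- Modulo 3 the form is (a + b)², so it is never 2. This later excludes prime elements of norm p
    -- when p ≡ 2 mod 3.
    have ha : a % 3 = 0 ∨ a % 3 = 1 ∨ a % 3 = 2 := by omega
    have hb : b % 3 = 0 ∨ b % 3 = 1 ∨ b % 3 = 2 := by omega
    rcases ha with ha | ha | ha <;> rcases hb with hb | hb | hb <;>
      rw [h4, ha, hb] at h3 <;> norm_num at h3

theorem isUnit_of_norm_eq_one {c : O →+* O} {x : O} (hx : x * c x = 1) :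
    IsUnit x :=
  IsUnit.of_mul_eq_one (c x) hx

theorem norm_unit [CharZero O] (h : IsEisenstein η c) {x : O} (hx : IsUnit x) : x * c x = 1 := by
  obtain ⟨y, hy⟩ := hx.exists_right_inv
  obtain ⟨n, hn, -⟩ := h.exists_nat_norm x
  obtain ⟨m, hm, -⟩ := h.exists_nat_norm y
  have : ((n * m : ℕ) : O) = ((1 : ℕ) : O) := by
    push_cast
    have := congrArg c hy
    rw [map_mul, map_one] at this
    rw [← hn, ← hm]
    linear_combination (c x * c y) * hy + this
  rw [hn, Nat.dvd_one.1 (Dvd.intro m (Nat.cast_injective this)), Nat.cast_one]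

theorem unit_pow_six [CharZero O] (h : IsEisenstein η c) {x : O} (hx : IsUnit x) : x ^ 6 = 1 := by
  have h1 := h.norm_unit hx
  obtain ⟨a, b, rfl⟩ := h.span x
  have h2 : ((a ^ 2 - a * b + b ^ 2 : ℤ) : O) = ((1 : ℤ) : O) := by
    rw [Int.cast_one, ← h1]
    simp only [map_add, map_mul, map_intCast, h.conj]
    push_cast
    linear_combination - b ^ 2 * h.pow_three - a * b * h.root
  have h3 : a ^ 2 - a * b + b ^ 2 = 1 := Int.cast_injective h2
  have ha : -1 ≤ a ∧ a ≤ 1 := by constructor <;> nlinarith [sq_nonneg (2 * b - a)]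
  have hb : -1 ≤ b ∧ b ≤ 1 := by constructor <;> nlinarith [sq_nonneg (2 * a - b)]
  have h6 : η ^ 6 = 1 := by linear_combination (η ^ 3 + 1) * h.pow_three
  obtain ⟨ha1, ha2⟩ := ha
  obtain ⟨hb1, hb2⟩ := hb
  interval_cases a <;> interval_cases b <;>
    first
    | (exfalso; revert h3; norm_num; done)
    | (push_cast; linear_combination h6)
    | (push_cast; linear_combination (η ^ 4 + 5 * η ^ 3 + 9 * η ^ 2 + 6 * η) * h.root)
    | (push_cast; ring)


end IsEisenstein

variable {Ω : Type*} [Field Ω] [Algebra ℚ Ω] [IsAlgClosed Ω]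

/-- The twist `a * c(a)²` becomes a cube in the union of the cyclotomic fields. -/
def IsCycloCube (ι : O →+* Ω) (c : O →+* O) (a : O) : Prop :=
  ∃ x ∈ cycloUnion Ω, x ^ 3 = ι (a * c a ^ 2)

namespace IsCycloCube

variable {ι : O →+* Ω}

theorem mul {a b : O} (ha : IsCycloCube ι c a) (hb : IsCycloCube ι c b) :
    IsCycloCube ι c (a * b) := by
  obtain ⟨x, hx, hxa⟩ := ha
  obtain ⟨y, hy, hyb⟩ := hb
  refine ⟨x * y, mul_mem hx hy, ?_⟩
  rw [mul_pow, hxa, hyb, ← map_mul, map_mul c]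
  ring_nf

theorem of_isUnit [CharZero O] (h : IsEisenstein η c) {a : O} (ha : IsUnit a) :
    IsCycloCube ι c a := by
  obtain ⟨x, hx⟩ := IsAlgClosed.exists_pow_nat_eq (ι (a * c a ^ 2)) three_pos
  -- Units are sixth roots of unity, so a cube root of the twist is an 18th root of unity.
  refine ⟨x, mem_cycloUnion_of_pow_eq_one (n := 18) (by norm_num) ?_, hx⟩
  calc x ^ 18 = (x ^ 3) ^ 6 := by ring
    _ = 1 := by
      have h6 := h.unit_pow_six ha
      have hc6 : c a ^ 6 = 1 := by rw [← map_pow, h6, map_one]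
      rw [hx, ← map_pow, mul_pow, ← pow_mul, mul_comm 2 6, pow_mul, h6, hc6]
      simp

theorem natCast (n : ℕ) : IsCycloCube ι c (n : O) :=
  ⟨n, (cycloUnion Ω).natCast_mem n, by simp; ring⟩

/-- The twists of a and of c(a) multiply to N(a)³, so N(a)/x is a cube root of the second when x is
one of the first. -/
theorem conj [IsDomain O] (h : IsEisenstein η c) (hι : Function.Injective ι) {a : O}
    (ha : IsCycloCube ι c a)
    (h0 : a ≠ 0) : IsCycloCube ι c (c a) := by
  obtain ⟨x, hx, hxa⟩ := ha
  obtain ⟨n, hn, -⟩ := h.exists_nat_norm a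
  have hc0 : c a ≠ 0 := fun h' => h0 (by rw [← h.conj_conj a, h', map_zero])
  have hx0 : x ^ 3 ≠ 0 := by
    rw [hxa]
    exact (map_ne_zero_iff ι hι).2 (mul_ne_zero h0 (pow_ne_zero 2 hc0))
  refine ⟨n / x, div_mem ((cycloUnion Ω).natCast_mem n) hx, ?_⟩
  rw [div_pow, div_eq_iff hx0, hxa, ← map_natCast ι, ← hn, h.conj_conj, ← map_pow, ← map_mul]
  congr 1
  ring

/-- Associates of a divisor of a rational prime. -/
theorem of_prime [CharZero O] [IsDomain O] [UniqueFactorizationMonoid O] (h : IsEisenstein η c)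
    (hJ : ∀ p : ℕ, p.Prime → p % 3 = 1 → ∃ J : O, J * c J = p ∧ IsCycloCube ι c J)
    (hι : Function.Injective ι) {π : O} (hπ : Prime π) : IsCycloCube ι c π := by
  obtain ⟨n, hn, hn2⟩ := h.exists_nat_norm π
  have hc0 : c π ≠ 0 := fun h' => hπ.ne_zero (by rw [← h.conj_conj π, h', map_zero])
  have hn0 : n ≠ 0 := by
    rintro rfl
    exact mul_ne_zero hπ.ne_zero hc0 (by simpa using hn)
  obtain ⟨p, hp, hpπ⟩ : ∃ p : ℕ, p.Prime ∧ π ∣ (p : O) := by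
    have : π ∣ (n.primeFactorsList.map (fun q : ℕ => (q : O))).prod := by
      rw [← Nat.cast_list_prod, Nat.prod_primeFactorsList hn0, ← hn]
      exact dvd_mul_right _ _
    obtain ⟨q, hq, hd⟩ := (hπ.dvd_prod_iff).1 this
    obtain ⟨p, hp, rfl⟩ := List.mem_map.1 hq
    exact ⟨p, Nat.prime_of_mem_primeFactorsList hp, hd⟩
  obtain ⟨κ, hκ⟩ := hpπ
  obtain ⟨m, hm, -⟩ := h.exists_nat_norm κ
  -- Taking norms in p = πκ leaves three cases, N(π) = 1, p or p²; the first would make π a unit.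
  have hnm : n * m = p ^ 2 := by
    have : ((n * m : ℕ) : O) = ((p ^ 2 : ℕ) : O) := by
      have := congrArg c hκ
      rw [map_natCast, map_mul] at this
      push_cast
      rw [← hn, ← hm, pow_two]
      nth_rw 2 [this]
      rw [hκ]
      ring
    exact Nat.cast_injective this
  obtain ⟨i, hi, rfl⟩ := (Nat.dvd_prime_pow hp).1 (Dvd.intro m hnm)
  interval_cases i
  · exact absurd (IsEisenstein.isUnit_of_norm_eq_one (c := c) (by simpa using hn)) hπ.not_isUnit
  · rw [pow_one] at hn hn2
    -- Here N(π) = p, so π is an associate of any J of norm p that it divides, and units are already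
    -- settled.
    have hdvd : ∀ J : O, J * c J = (p : O) → π ∣ J → IsCycloCube ι c J → IsCycloCube ι c π := by
      rintro J hJp ⟨u, rfl⟩ hcube
      have hu : IsUnit u := by
        refine IsEisenstein.isUnit_of_norm_eq_one (c := c) ?_
        have hp0 : (p : O) ≠ 0 := Nat.cast_ne_zero.2 hp.ne_zero
        refine mul_left_cancel₀ hp0 ?_
        rw [mul_one]
        nth_rw 1 [← hn]
        rw [← hJp, map_mul]
        ring
      obtain ⟨v, hv⟩ := hu.exists_right_inv
      have hv' : IsUnit v := IsUnit.of_mul_eq_one u (by rw [mul_comm, hv])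
      have := hcube.mul (of_isUnit h hv')
      rwa [mul_assoc, hv, mul_one] at this
    have h3 : p % 3 = 0 ∨ p % 3 = 1 := by omega
    rcases h3 with h3 | h3
    · have hp3 : p = 3 := ((Nat.prime_dvd_prime_iff_eq Nat.prime_three hp).1
        (Nat.dvd_of_mod_eq_zero h3)).symm
      subst hp3
      have hl : (η - 1) * c (η - 1) = (3 : ℕ) := by
        rw [map_sub, map_one, h.conj]
        push_cast
        linear_combination (η - 2) * h.root
      refine hdvd (η - 1) hl ?_ ?_
      · have : π ∣ (η - 1) ^ 2 := by
          refine ⟨-η * κ, ?_⟩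
          rw [← mul_assoc, mul_comm π, mul_assoc, ← hκ]
          push_cast
          linear_combination h.root
        exact hπ.dvd_of_dvd_pow this
      -- With λ = η - 1 the twist is λ·c(λ)² = ηλ³, whose cube root is λ times a ninth root of
      -- unity.
      · obtain ⟨x, hx⟩ := IsAlgClosed.exists_pow_nat_eq (ι η) three_pos
        have hη : ι η ^ 3 = 1 := by rw [← map_pow, h.pow_three, map_one]
        have hx9 : x ^ 9 = 1 := by
          rw [← hη, ← hx]
          ring
        refine ⟨x * (ι η - 1), mul_mem (mem_cycloUnion_of_pow_eq_one (by norm_num) hx9)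
          (sub_mem (mem_cycloUnion_of_pow_eq_one three_ne_zero hη) (one_mem _)), ?_⟩
        rw [mul_pow, hx, ← map_one ι, ← map_sub, ← map_pow, ← map_mul, map_sub, map_one, h.conj]
        congr 1
        linear_combination -(η - 1) ^ 3 * h.root
    · obtain ⟨J, hJp, hJc⟩ := hJ p hp h3
      have hJ0 : J ≠ 0 := by
        rintro rfl
        rw [zero_mul] at hJp
        exact Nat.cast_ne_zero.2 hp.ne_zero hJp.symm
      have : π ∣ J * c J := by
        rw [hJp, ← hn]
        exact dvd_mul_right _ _
      rcases hπ.dvd_or_dvd this with hd | hd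
      · exact hdvd J hJp hd hJc
      · exact hdvd (c J) (by rw [h.conj_conj, mul_comm, hJp]) hd (hJc.conj h hι hJ0)
  -- Norm p² makes κ a unit, so π is an associate of the rational integer p.
  · have hm1 : m = 1 := by
      have : 0 < p ^ 2 := pow_pos hp.pos 2
      nlinarith
    have hκu : IsUnit κ := IsEisenstein.isUnit_of_norm_eq_one (c := c) (by simpa [hm1] using hm)
    obtain ⟨v, hv⟩ := hκu.exists_right_inv
    have hv' : IsUnit v := IsUnit.of_mul_eq_one κ (by rw [mul_comm, hv])
    have := (natCast (ι := ι) (c := c) p).mul (of_isUnit h hv')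
    rwa [hκ, mul_assoc, hv, mul_one] at this

theorem of_uniqueFactorization [CharZero O] [IsDomain O] [UniqueFactorizationMonoid O]
    (h : IsEisenstein η c)
    (hJ : ∀ p : ℕ, p.Prime → p % 3 = 1 → ∃ J : O, J * c J = p ∧ IsCycloCube ι c J)
    (hι : Function.Injective ι) (a : O) : IsCycloCube ι c a := by
  induction a using UniqueFactorizationMonoid.induction_on_prime with
  | h₁ => exact ⟨0, zero_mem _, by simp⟩
  | h₂ x hx => exact of_isUnit h hx
  | h₃ a p _ hp ha => exact (of_prime h hJ hι hp).mul ha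

end IsCycloCube

end Eisenstein


/-! ### Gauss and Jacobi sums of a cubic character -/

section GaussSums

variable {O : Type*} [CommRing O] [IsDomain O] [CharZero O] {η : O} {c : O →+* O}
variable {Ω : Type*} [Field Ω] [Algebra ℚ Ω] [IsAlgClosed Ω]

/-- For χ of order 3 mod p, J = J(χ,χ) has J·c(J) = p, and the Gauss sum, a sum of products of roots
of unity, has cube pJ = J²c(J). That is the twist of c(J); conjugating gives the claim for J. -/
theorem exists_jacobiSum_isCycloCube (h : IsEisenstein η c) (hη : IsPrimitiveRoot η 3)
    {ι : O →+* Ω} (hι : Function.Injective ι) (p : ℕ) (hp : p.Prime) (hp3 : p % 3 = 1) :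
    ∃ J : O, J * c J = p ∧ IsCycloCube ι c J := by
  have : Fact p.Prime := ⟨hp⟩
  have hΩ : CharZero Ω := algebraRat.charZero Ω
  have : NeZero p := ⟨hp.ne_zero⟩
  obtain ⟨χ, hχ⟩ := MulChar.exists_mulChar_orderOf (ZMod p) (n := 3)
    (by rw [ZMod.card]; omega) hη
  have hχ3 : χ ^ 3 = 1 := hχ ▸ pow_orderOf_eq_one χ
  have hχ1 : χ ≠ 1 := by rintro rfl; simp at hχ
  have hχ2 : χ ^ 2 = χ⁻¹ := eq_inv_of_mul_eq_one_left (by rw [← pow_succ, hχ3])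
  have hχχ : χ * χ ≠ 1 := by
    rw [← pow_two, hχ2]
    exact inv_ne_one.2 hχ1
  have hcχ : χ.ringHomComp c = χ⁻¹ := by
    rw [← hχ2]
    ext a
    obtain ⟨k, -, hk⟩ := MulChar.exists_apply_eq_pow hχ3 hη a.ne_zero
    simp only [MulChar.ringHomComp_apply, MulChar.pow_apply_coe]
    rw [hk, map_pow, h.conj]
    ring
  have hcJ : c (jacobiSum χ χ) = jacobiSum χ⁻¹ χ⁻¹ := by
    rw [← hcχ, jacobiSum_ringHomComp]
  obtain ⟨ζ, hζ⟩ := exists_isPrimitiveRoot Ω p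
  let ψ : AddChar (ZMod p) Ω := AddChar.zmodChar p hζ.pow_eq_one
  have hψ : ψ.IsPrimitive := AddChar.zmodChar_primitive_of_primitive_root p hζ
  set χ' := χ.ringHomComp ι with hχ'
  have hinj : ∀ φ : MulChar (ZMod p) O, φ ≠ 1 → φ.ringHomComp ι ≠ 1 := fun φ hφ =>
    (MulChar.ringHomComp_ne_one_iff hι).2 hφ
  have hord : orderOf χ' = 3 := by
    have : Fact (Nat.Prime 3) := ⟨Nat.prime_three⟩
    refine orderOf_eq_prime ?_ (hinj χ hχ1)
    rw [hχ', MulChar.ringHomComp_pow, hχ3, MulChar.ringHomComp_one]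
  have hJJ : jacobiSum χ χ * c (jacobiSum χ χ) = p := by
    apply hι
    rw [hcJ, map_mul, ← jacobiSum_ringHomComp, ← jacobiSum_ringHomComp, ← MulChar.ringHomComp_inv,
      jacobiSum_mul_jacobiSum_inv _ (hinj χ hχ1) (hinj χ hχ1), ZMod.card, map_natCast]
    · rw [← MulChar.ringHomComp_mul]
      exact hinj _ hχχ
    · rw [ZMod.ringChar_zmod_n, (ringChar.eq_iff (p := 0)).2 inferInstance]
      exact hp.ne_zero.symm
  have hg : gaussSum χ' ψ ^ 3 = ι (p * jacobiSum χ χ) := by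
    have h1 := gaussSum_pow_eq_prod_jacobiSum (χ := χ') (ψ := ψ) (by omega) hψ
    -- χ(-1) = χ((-1)³) = χ(-1)³ = 1.
    have h2 : χ' (-1) = 1 := by
      have : χ' (-1) ^ 3 = 1 := by
        rw [← MulChar.pow_apply' _ three_ne_zero, ← hord, pow_orderOf_eq_one,
          MulChar.one_apply (by simp)]
      rw [← map_pow] at this
      simpa [Odd.neg_one_pow (by decide : Odd 3)] using this
    rw [hord, h2] at h1
    simp only [one_mul, ZMod.card] at h1
    rw [h1, map_mul, map_natCast, ← jacobiSum_ringHomComp]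
    simp [hχ']
  have hgmem : gaussSum χ' ψ ∈ cycloUnion Ω := by
    refine sum_mem fun a _ => mul_mem ?_ ?_
    · by_cases ha : a = 0
      · rw [ha, MulChar.map_zero]
        exact zero_mem _
      · refine mem_cycloUnion_of_pow_eq_one three_ne_zero ?_
        rw [← MulChar.pow_apply' _ three_ne_zero, ← hord, pow_orderOf_eq_one,
          MulChar.one_apply (isUnit_iff_ne_zero.2 ha)]
    · refine mem_cycloUnion_of_pow_eq_one hp.ne_zero ?_
      rw [← AddChar.map_nsmul_eq_pow]
      simp
  have hJ0 : jacobiSum χ χ ≠ 0 := by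
    intro h0
    rw [h0, zero_mul] at hJJ
    exact Nat.cast_ne_zero.2 hp.ne_zero hJJ.symm
  have hcJ0 : c (jacobiSum χ χ) ≠ 0 := fun h' =>
    hJ0 (by rw [← h.conj_conj (jacobiSum χ χ), h', map_zero])
  have hcube : IsCycloCube ι c (c (jacobiSum χ χ)) := by
    refine ⟨_, hgmem, ?_⟩
    rw [hg, h.conj_conj, ← hJJ]
    congr 1
    ring
  refine ⟨jacobiSum χ χ, hJJ, ?_⟩
  have := hcube.conj h hι hcJ0
  rwa [h.conj_conj] at this

end GaussSums

/-! ### The ring of integers of ℚ(ζ₃) -/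

section Integers

open NumberField

variable (k : Type*) [Field k] [NumberField k] [IsCyclotomicExtension {3} ℚ k]

theorem exists_isEisenstein : ∃ (η : 𝓞 k) (c : 𝓞 k →+* 𝓞 k),
    IsPrimitiveRoot η 3 ∧ IsEisenstein η c := by
  have : IsGalois ℚ k := IsCyclotomicExtension.isGalois {3} ℚ k
  let ζ := IsCyclotomicExtension.zeta 3 ℚ k
  have hζ : IsPrimitiveRoot ζ 3 := IsCyclotomicExtension.zeta_spec 3 ℚ k
  have hη := hζ.toInteger_isPrimitiveRoot
  have hroot : hζ.toInteger ^ 2 + hζ.toInteger + 1 = 0 :=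
    IsCyclotomicExtension.Rat.Three.eta_sq_add_eta_add_one hζ
  let σ : Gal(k/ℚ) := (IsCyclotomicExtension.Rat.galEquivZMod 3 k).symm (-1)
  let c : 𝓞 k →+* 𝓞 k := RingOfIntegers.mapRingHom (σ : k →+* k)
  refine ⟨hζ.toInteger, c, hη, hroot, ?_, ?_⟩
  · intro x
    have hx : x ∈ Algebra.adjoin ℤ {hζ.toInteger} := by
      have h1 : IsPrimitiveRoot ζ (3 ^ 1) := by rwa [pow_one]
      have : IsCyclotomicExtension {3 ^ 1} ℚ k := by rwa [pow_one]
      have hp : Fact (Nat.Prime 3) := ⟨Nat.prime_three⟩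
      have h2 := h1.integralPowerBasisOfPrimePow.adjoin_gen_eq_top
      rw [h1.integralPowerBasisOfPrimePow_gen] at h2
      have h3 : x ∈ Algebra.adjoin ℤ {h1.toInteger} := h2 ▸ Algebra.mem_top
      exact h3
    induction hx using Algebra.adjoin_induction with
    | mem y hy =>
      rw [Set.mem_singleton_iff.1 hy]
      exact ⟨0, 1, by simp⟩
    | algebraMap r => exact ⟨r, 0, by simp⟩
    | add y z _ _ hy hz =>
      obtain ⟨a, b, rfl⟩ := hy
      obtain ⟨a', b', rfl⟩ := hz
      exact ⟨a + a', b + b', by push_cast; ring⟩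
    | mul y z _ _ hy hz =>
      obtain ⟨a, b, hy⟩ := hy
      obtain ⟨a', b', hz⟩ := hz
      refine ⟨a * a' - b * b', a * b' + b * a' - b * b', ?_⟩
      rw [hy, hz]
      push_cast
      linear_combination b * b' * hroot
  · apply RingOfIntegers.ext
    change σ ζ = ζ ^ 2
    rw [IsCyclotomicExtension.Rat.galEquivZMod_apply_of_pow_eq 3 k σ hζ.pow_eq_one,
      MulEquiv.apply_symm_apply]
    rfl

end Integers

/-! ### Kronecker–Weber for cyclic cubic fields -/

section KroneckerWeber

attribute [local instance] inheritedAlgebra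

variable {Ω : Type*} [Field Ω] [Algebra ℚ Ω] [IsAlgClosed Ω]

theorem exists_intCast_eq_of_fixed {K : Type*} [Field K] [Algebra ℚ K] [FiniteDimensional ℚ K]
    [IsGalois ℚ K] {σ : K ≃ₐ[ℚ] K} (hσ : ∀ τ, τ ∈ Subgroup.zpowers σ) {x : K}
    (hx : IsIntegral ℤ x) (h : σ x = x) : ∃ n : ℤ, x = n := by
  have h1 : ∀ τ : K ≃ₐ[ℚ] K, τ x = x := by
    intro τ
    have : Subgroup.zpowers σ ≤ MulAction.stabilizer (K ≃ₐ[ℚ] K) x := by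
      simpa using h
    exact this (hσ τ)
  obtain ⟨q, rfl⟩ := IntermediateField.mem_bot.1 ((IsGalois.mem_bot_iff_fixed x).2 h1)
  have hq : IsIntegral ℤ q := (isIntegral_algebraMap_iff (algebraMap ℚ K).injective).1 hx
  obtain ⟨n, rfl⟩ := IsIntegrallyClosed.isIntegral_iff.1 hq
  exact ⟨n, by simp⟩

/-- From qS = RS² one gets (qS)³ = a·c(a)², so qS differs from a cyclotomic cube root by a cube root
of unity. Dividing by q gives S, and then R = q/S. -/
theorem mem_cycloUnion_of_resolvents {O : Type*} [CommRing O] {η : O} {c : O →+* O}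
    (h : IsEisenstein η c) {ι : O →+* Ω} (hcube : ∀ a, IsCycloCube ι c a) {a : O} {q : ℤ}
    {R S : Ω} (hι : Function.Injective ι) (hR : R ^ 3 = ι a) (hS : S ^ 3 = ι (c a))
    (hRS : R * S = q) : R ∈ cycloUnion Ω ∧ S ∈ cycloUnion Ω := by
  by_cases ha : a = 0
  · have hR0 : R = 0 := by simpa [ha] using hR
    have hS0 : S = 0 := by simpa [ha] using hS
    exact ⟨hR0 ▸ zero_mem _, hS0 ▸ zero_mem _⟩
  have hca : c a ≠ 0 := fun h' => ha (by rw [← h.conj_conj a, h', map_zero])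
  have hR0 : R ≠ 0 := by
    rintro rfl
    exact (map_ne_zero_iff ι hι).2 ha (by simpa using hR.symm)
  have hS0 : S ≠ 0 := by
    rintro rfl
    exact (map_ne_zero_iff ι hι).2 hca (by simpa using hS.symm)
  have hq : (q : Ω) ≠ 0 := hRS ▸ mul_ne_zero hR0 hS0
  have hqm : (q : Ω) ∈ cycloUnion Ω := intCast_mem _ q
  obtain ⟨x, hx, hxa⟩ := hcube a
  have hqS : q * S ∈ cycloUnion Ω := by
    refine mem_cycloUnion_of_pow_three_eq hx ?_
    rw [hxa, map_mul, map_pow, ← hR, ← hS, ← hRS]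
    ring
  have hSm : S ∈ cycloUnion Ω := by
    have := div_mem hqS hqm
    rwa [mul_div_cancel_left₀ _ hq] at this
  refine ⟨?_, hSm⟩
  rw [eq_div_of_mul_eq hS0 hRS]
  exact div_mem hqm hSm

theorem le_cycloUnion {K : IntermediateField ℚ Ω} (hK : IsCyclicCubic K) : K ≤ cycloUnion Ω := by
  have hgal := hK.isGalois
  have hcyc := hK.isCyclic
  have : FiniteDimensional ℚ K := Module.finite_of_finrank_eq_succ hK.finrank_eq
  have : CharZero Ω := algebraRat.charZero Ω
  obtain ⟨σ, hσ⟩ := hcyc.exists_generator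
  have hcard : Nat.card (K ≃ₐ[ℚ] K) = 3 := by
    rw [IsGalois.card_aut_eq_finrank, hK.finrank_eq]
  have hσ3 : ∀ x, σ (σ (σ x)) = x := by
    intro x
    have := pow_card_eq_one' (x := σ)
    rw [hcard] at this
    exact congrArg (fun τ : K ≃ₐ[ℚ] K => τ x) this
  let k := CyclotomicField 3 ℚ
  have : IsCyclotomicExtension {3} ℚ k := CyclotomicField.isCyclotomicExtension 3 ℚ
  have := IsCyclotomicExtension.integral {3} ℚ k
  have hnf : NumberField k := inferInstance
  obtain ⟨η, c, hη, hE⟩ := exists_isEisenstein k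
  let φ : k →ₐ[ℚ] Ω := IsAlgClosed.lift
  let ι : NumberField.RingOfIntegers k →+* Ω :=
    (φ : k →+* Ω).comp (algebraMap (NumberField.RingOfIntegers k) k)
  have hι : Function.Injective ι :=
    φ.injective.comp (FaithfulSMul.algebraMap_injective _ _)
  have := IsCyclotomicExtension.Rat.three_pid k
  have hcube : ∀ a, IsCycloCube ι c a := fun a =>
    IsCycloCube.of_uniqueFactorization hE (exists_jacobiSum_isCycloCube hE hη hι) hι a
  -- For integral x with conjugates y, z, the σ-invariant integers t, q, A, B, C are the trace, the
  -- product RS of the Lagrange resolvents, and the coefficients in R³ = A + 3Bω + 3Cω².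
  have hint : ∀ θ : K, IsIntegral ℤ θ → (θ : Ω) ∈ cycloUnion Ω := by
    intro x hx
    set y := σ x with hy
    set z := σ y with hz
    have hzx : σ z = x := hσ3 x
    have hyi : IsIntegral ℤ y := hx.map σ
    have hzi : IsIntegral ℤ z := hyi.map σ
    have h6 : IsIntegral ℤ (6 : K) := by
      simpa using isIntegral_algebraMap (R := ℤ) (A := K) (x := 6)
    obtain ⟨t, ht⟩ := exists_intCast_eq_of_fixed hσ (x := x + y + z) ((hx.add hyi).add hzi)
      (by simp only [map_add, ← hy, ← hz, hzx]; ring)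
    obtain ⟨q, hq⟩ := exists_intCast_eq_of_fixed hσ
      (x := x ^ 2 + y ^ 2 + z ^ 2 - x * y - y * z - z * x)
      ((((((hx.pow 2).add (hyi.pow 2)).add (hzi.pow 2)).sub (hx.mul hyi)).sub
        (hyi.mul hzi)).sub (hzi.mul hx))
      (by simp only [map_add, map_sub, map_mul, map_pow, ← hy, ← hz, hzx]; ring)
    obtain ⟨A, hA⟩ := exists_intCast_eq_of_fixed hσ
      (x := x ^ 3 + y ^ 3 + z ^ 3 + 6 * (x * y * z))
      ((((hx.pow 3).add (hyi.pow 3)).add (hzi.pow 3)).add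
        (h6.mul ((hx.mul hyi).mul hzi)))
      (by simp only [map_add, map_mul, map_pow, map_ofNat, ← hy, ← hz, hzx]; ring)
    obtain ⟨B, hB⟩ := exists_intCast_eq_of_fixed hσ
      (x := x ^ 2 * y + y ^ 2 * z + z ^ 2 * x)
      ((((hx.pow 2).mul hyi).add ((hyi.pow 2).mul hzi)).add ((hzi.pow 2).mul hx))
      (by simp only [map_add, map_mul, map_pow, ← hy, ← hz, hzx]; ring)
    obtain ⟨C, hC⟩ := exists_intCast_eq_of_fixed hσ
      (x := x ^ 2 * z + y ^ 2 * x + z ^ 2 * y)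
      ((((hx.pow 2).mul hzi).add ((hyi.pow 2).mul hx)).add ((hzi.pow 2).mul hyi))
      (by simp only [map_add, map_mul, map_pow, ← hy, ← hz, hzx]; ring)
    replace ht := congrArg (algebraMap K Ω) ht
    replace hq := congrArg (algebraMap K Ω) hq
    replace hA := congrArg (algebraMap K Ω) hA
    replace hB := congrArg (algebraMap K Ω) hB
    replace hC := congrArg (algebraMap K Ω) hC
    simp only [map_add, map_sub, map_mul, map_pow, map_ofNat, map_intCast] at ht hq hA hB hC
    change algebraMap K Ω x ∈ _
    generalize algebraMap K Ω x = x at *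
    generalize algebraMap K Ω y = y at *
    generalize algebraMap K Ω z = z at *
    set ω := ι η with hω
    have hω2 : ω ^ 2 + ω + 1 = 0 := by
      rw [hω, ← map_pow, ← map_add, ← map_one ι, ← map_add, hE.root, map_zero]
    have hω3 : ω ^ 3 = 1 := by rw [hω, ← map_pow, hE.pow_three, map_one]
    obtain ⟨hR, hS⟩ := mem_cycloUnion_of_resolvents hE hcube (hι := hι)
      (a := A + 3 * B * η + 3 * C * η ^ 2) (q := q)
      (R := x + ω * y + ω ^ 2 * z) (S := x + ω ^ 2 * y + ω * z)
      (by
        simp only [map_add, map_mul, map_pow, map_ofNat, map_intCast, ← hω]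
        rw [← hA, ← hB, ← hC]
        linear_combination (y ^ 3 + (ω ^ 3 + 1) * z ^ 3 + 3 * ω * x * z ^ 2 + 3 * ω * y ^ 2 * z +
          3 * ω ^ 2 * y * z ^ 2 + 6 * x * y * z) * hω3)
      (by
        simp only [map_add, map_mul, map_pow, map_ofNat, map_intCast, hE.conj, ← hω]
        rw [← hA, ← hB, ← hC]
        linear_combination ((ω ^ 3 + 1) * y ^ 3 + z ^ 3 - 3 * ω * x ^ 2 * z +
          3 * ω ^ 2 * y ^ 2 * z +
          6 * x * y * z) * hω3)
      (by
        rw [← hq]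
        linear_combination (y ^ 2 + z ^ 2 + ω * y * z) * hω3 + (x * y + x * z + y * z) * hω2)
    -- Inversion of the resolvents: in t + R + S the conjugates y and z occur with coefficient 1 + ω
    -- + ω² = 0.
    have : x = (t + (x + ω * y + ω ^ 2 * z) + (x + ω ^ 2 * y + ω * z)) / 3 := by
      rw [← ht]
      linear_combination - (y + z) / 3 * hω2
    rw [this]
    exact div_mem (add_mem (add_mem (intCast_mem _ t) hR) hS) (ofNat_mem _ 3)
  intro x hx
  have halg : IsAlgebraic ℤ (⟨x, hx⟩ : K) :=
    (IsFractionRing.isAlgebraic_iff ℤ ℚ K).2 (Algebra.IsAlgebraic.isAlgebraic _)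
  obtain ⟨m, hm, hmx⟩ := halg.exists_integral_multiple
  have h1 : (m : Ω) * x ∈ cycloUnion Ω := by
    have := hint _ hmx
    simpa using this
  have h2 := div_mem h1 (intCast_mem _ m)
  rwa [mul_div_cancel_left₀ _ (Int.cast_ne_zero.2 hm)] at h2

theorem exists_le_cyclo {K : IntermediateField ℚ Ω} (hK : IsCyclicCubic K) :
    ∃ n : ℕ, n ≠ 0 ∧ K ≤ cyclo Ω n :=
  exists_le_cyclo_of_le_cycloUnion (by rw [hK.finrank_eq]; norm_num) (le_cycloUnion hK)

end KroneckerWeber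

end CyclicCubic

/-! ### Conductors and torsion counts -/

namespace CyclicCubic

theorem embedsInCyclotomic_iff (K : CyclicCubicField) (n : ℕ) :
    EmbedsInCyclotomic K.1 n ↔ 0 < n ∧ K.1 ≤ cyclo (AlgebraicClosure ℚ) n := by
  refine and_congr_right fun hn => ?_
  have : NeZero n := ⟨hn.ne'⟩
  have : IsCyclotomicExtension {n} ℚ (CyclotomicField n ℚ) :=
    CyclotomicField.isCyclotomicExtension n ℚ
  have : @IsGalois ℚ _ K.1 _ K.1.algebra' := K.2.isGalois
  exact nonempty_algHom_iff_le_cyclo K.1 n (CyclotomicField n ℚ)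

theorem exists_embedsInCyclotomic (K : CyclicCubicField) :
    ∃ n : ℕ, EmbedsInCyclotomic K.1 n := by
  obtain ⟨n, hn, h⟩ := exists_le_cyclo (K := K.1) K.2
  exact ⟨n, (embedsInCyclotomic_iff K n).2 ⟨Nat.pos_of_ne_zero hn, h⟩⟩

theorem conductor_spec (K : CyclicCubicField) :
    0 < conductor K.1 ∧ K.1 ≤ cyclo (AlgebraicClosure ℚ) (conductor K.1) :=
  (embedsInCyclotomic_iff K _).1 (Nat.sInf_mem (exists_embedsInCyclotomic K))

/-- If K lies in ℚ(ζₙ) it also lies in ℚ(ζ_gcd(f,n)), and minimality of f forces gcd(f,n) = f. -/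
theorem le_cyclo_iff_conductor_dvd (K : CyclicCubicField) {n : ℕ} (hn : n ≠ 0) :
    K.1 ≤ cyclo (AlgebraicClosure ℚ) n ↔ conductor K.1 ∣ n := by
  obtain ⟨h0, h⟩ := conductor_spec K
  refine ⟨fun h1 => ?_, fun h1 => h.trans (cyclo_le_of_dvd hn h1)⟩
  have h2 := le_cyclo_gcd h0.ne' hn h h1
  have h3 : conductor K.1 ≤ (conductor K.1).gcd n := Nat.sInf_le
    ((embedsInCyclotomic_iff K _).2 ⟨Nat.gcd_pos_of_pos_left _ h0, h2⟩)
  exact Nat.gcd_eq_left_iff_dvd.1 (le_antisymm (Nat.gcd_le_left _ h0) h3)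

/-- The number of elements of exponent `3` in `(ℤ/nℤ)ˣ`. -/
noncomputable def cubeTorsion (n : ℕ) : ℕ := Nat.card {u : (ZMod n)ˣ // u ^ 3 = 1}

theorem card_conductor_dvd {n : ℕ} (hn : n ≠ 0) :
    {K : CyclicCubicField | conductor K.1 ∣ n}.Finite ∧
    2 * {K : CyclicCubicField | conductor K.1 ∣ n}.ncard + 1 = cubeTorsion n := by
  have : NeZero n := ⟨hn⟩
  obtain ⟨h1, h2⟩ := card_cubic_le_cyclo (Ω := AlgebraicClosure ℚ) n
  have himg : Subtype.val '' {K : CyclicCubicField | conductor K.1 ∣ n} =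
      {K : IntermediateField ℚ (AlgebraicClosure ℚ) |
        K ≤ cyclo (AlgebraicClosure ℚ) n ∧ IsCyclicCubic K} := by
    ext K
    constructor
    · rintro ⟨K, hK, rfl⟩
      exact ⟨(le_cyclo_iff_conductor_dvd K hn).2 hK, K.2⟩
    · rintro ⟨hK, hK'⟩
      exact ⟨⟨K, hK'⟩, (le_cyclo_iff_conductor_dvd ⟨K, hK'⟩ hn).1 hK, rfl⟩
  have h3 : (Subtype.val '' {K : CyclicCubicField | conductor K.1 ∣ n}).Finite := by
    rw [himg]
    exact h1
  refine ⟨h3.of_finite_image Subtype.val_injective.injOn, ?_⟩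
  rw [cubeTorsion, ← h2]
  change _ = 2 * Set.ncard {K : IntermediateField ℚ (AlgebraicClosure ℚ) |
        K ≤ cyclo (AlgebraicClosure ℚ) n ∧ IsCyclicCubic K} + 1
  rw [← himg, Set.ncard_image_of_injective _ Subtype.val_injective]

/-- The number of cyclic cubic fields of conductor `n`. -/
noncomputable def fieldCount (n : ℕ) : ℕ := {K : CyclicCubicField | conductor K.1 = n}.ncard

theorem finite_conductor_eq (n : ℕ) : {K : CyclicCubicField | conductor K.1 = n}.Finite := by
  rcases eq_or_ne n 0 with rfl | hn
  · convert Set.finite_empty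
    ext K
    simpa using (conductor_spec K).1.ne'
  · exact (card_conductor_dvd hn).1.subset fun K hK => dvd_of_eq hK

theorem finite_conductor_mem (s : Finset ℕ) :
    {K : CyclicCubicField | conductor K.1 ∈ s}.Finite := by
  have : {K : CyclicCubicField | conductor K.1 ∈ s} =
      ⋃ n ∈ s, {K : CyclicCubicField | conductor K.1 = n} := by
    ext K
    simp
  rw [this]
  exact s.finite_toSet.biUnion fun n _ => finite_conductor_eq n

theorem ncard_conductor_mem (s : Finset ℕ) :
    {K : CyclicCubicField | conductor K.1 ∈ s}.ncard = ∑ n ∈ s, fieldCount n := by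
  classical
  have h := finite_conductor_mem s
  rw [Set.ncard_eq_toFinset_card _ h,
    Finset.card_eq_sum_card_fiberwise (f := fun K : CyclicCubicField => conductor K.1) (t := s)]
  · refine Finset.sum_congr rfl fun n hn => ?_
    rw [fieldCount, ← Set.ncard_coe_finset]
    congr 1
    ext K
    simp only [Finset.coe_filter, Set.Finite.mem_toFinset, Set.mem_ofPred_eq]
    exact ⟨fun h => h.2, fun h => ⟨h ▸ hn, h⟩⟩
  · intro K hK
    simpa using hK

theorem two_mul_sum_fieldCount_add_one {n : ℕ} (hn : n ≠ 0) :
    2 * ∑ d ∈ n.divisors, fieldCount d + 1 = cubeTorsion n := by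
  rw [← ncard_conductor_mem, ← (card_conductor_dvd hn).2]
  simp [Nat.mem_divisors, hn]

theorem cubeTorsion_mul {m n : ℕ} (h : m.Coprime n) :
    cubeTorsion (m * n) = cubeTorsion m * cubeTorsion n := by
  let e : (ZMod (m * n))ˣ ≃* (ZMod m)ˣ × (ZMod n)ˣ :=
    (Units.mapEquiv (ZMod.chineseRemainder h).toMulEquiv).trans MulEquiv.prodUnits
  rw [cubeTorsion, cubeTorsion, cubeTorsion, ← Nat.card_prod]
  refine Nat.card_congr ((e.toEquiv.subtypeEquiv (q := fun u => u.1 ^ 3 = 1 ∧ u.2 ^ 3 = 1) ?_).trans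
    (Equiv.subtypeProdEquivProd (p := fun u => u ^ 3 = 1) (q := fun u => u ^ 3 = 1)))
  intro u
  rw [← e.map_eq_one_iff, map_pow, Prod.ext_iff]
  rfl

theorem cubeTorsion_eq_one {n : ℕ} [NeZero n] (h : ¬ 3 ∣ n.totient) : cubeTorsion n = 1 := by
  have : ∀ u : (ZMod n)ˣ, u ^ 3 = 1 ↔ u = 1 := by
    intro u
    refine ⟨fun hu => ?_, fun hu => by simp [hu]⟩
    have h1 : orderOf u ∣ 3 := orderOf_dvd_of_pow_eq_one hu
    have h2 : orderOf u ∣ n.totient := ZMod.card_units_eq_totient n ▸ orderOf_dvd_card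
    rcases (Nat.dvd_prime Nat.prime_three).1 h1 with h3 | h3
    · exact orderOf_eq_one_iff.1 h3
    · exact absurd (h3 ▸ h2) h
  simp [cubeTorsion, this]

theorem cubeTorsion_eq_three {n : ℕ} [NeZero n] [IsCyclic (ZMod n)ˣ] (h : 3 ∣ n.totient) :
    cubeTorsion n = 3 := by
  have h1 := IsCyclic.card_powMonoidHom_ker (G := (ZMod n)ˣ) 3
  rw [Nat.card_eq_fintype_card (α := (ZMod n)ˣ), ZMod.card_units_eq_totient,
    Nat.gcd_eq_right h] at h1
  exact h1

/-- The unit group has order p^(k-1)(p-1), divisible by 3 exactly when p ≡ 1 mod 3 or 9 ∣ p^k; in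
those cases p is odd and the group is cyclic. -/
theorem cubeTorsion_prime_pow {p : ℕ} (hp : p.Prime) {k : ℕ} (hk : k ≠ 0) :
    cubeTorsion (p ^ k) = if p % 3 = 1 ∨ (p = 3 ∧ 2 ≤ k) then 3 else 1 := by
  have : NeZero (p ^ k) := ⟨pow_ne_zero k hp.ne_zero⟩
  have ht := Nat.totient_prime_pow hp (Nat.pos_of_ne_zero hk)
  have h31 : (p - 1) % 3 = 0 ↔ p % 3 = 1 := by have := hp.one_lt; omega
  split_ifs with h
  · have hp2 : p ≠ 2 := by rintro rfl; simp at h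
    have : IsCyclic (ZMod (p ^ k))ˣ := ZMod.isCyclic_units_of_prime_pow p hp hp2 k
    apply cubeTorsion_eq_three
    rw [ht]
    rcases h with h | ⟨rfl, h⟩
    · exact Dvd.dvd.mul_left (Nat.dvd_of_mod_eq_zero (h31.2 h)) _
    · exact Dvd.dvd.mul_right (dvd_pow_self 3 (by omega)) _
  · apply cubeTorsion_eq_one
    rw [ht, Nat.prime_three.dvd_mul]
    rintro (h' | h')
    · have hk1 : k - 1 ≠ 0 := by rintro h0; simp [h0] at h'
      have := (Nat.prime_dvd_prime_iff_eq Nat.prime_three hp).1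
        (Nat.prime_three.dvd_of_dvd_pow h')
      exact h (Or.inr ⟨this.symm, by omega⟩)
    · exact h (Or.inl (h31.1 (Nat.mod_eq_zero_of_dvd h')))

end CyclicCubic

/-! ### The multiplicative count of cubic characters and its quotient by ζ * χ -/

namespace CyclicCubic

open ArithmeticFunction Finset
open scoped ArithmeticFunction.zeta ArithmeticFunction.Moebius

/-- The arithmetic function `n ↦ #(ℤ/nℤ)ˣ[3]`. -/
noncomputable def torsionFun : ArithmeticFunction ℤ :=
  ⟨fun n => if n = 0 then 0 else cubeTorsion n, by simp⟩

theorem torsionFun_apply {n : ℕ} (hn : n ≠ 0) : torsionFun n = cubeTorsion n := by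
  change (if n = 0 then (0 : ℤ) else cubeTorsion n) = _
  rw [if_neg hn]

theorem isMultiplicative_torsionFun : torsionFun.IsMultiplicative := by
  rw [IsMultiplicative.iff_ne_zero]
  refine ⟨?_, fun hm hn h => ?_⟩
  · rw [torsionFun_apply one_ne_zero, cubeTorsion_eq_one (by simp), Nat.cast_one]
  · rw [torsionFun_apply hm, torsionFun_apply hn, torsionFun_apply (mul_ne_zero hm hn),
      cubeTorsion_mul h, Nat.cast_mul]

/-- The number of cubic Dirichlet characters of conductor `n`, as an arithmetic function. -/
noncomputable def charFun : ArithmeticFunction ℤ := torsionFun * μ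

/-- Möbius inversion of the divisor-sum identity. The constant 1 there, the trivial character, is
the divisor sum of the indicator of n = 1. -/
theorem charFun_eq (n : ℕ) (hn : n ≠ 0) :
    charFun n = 2 * fieldCount n + if n = 1 then 1 else 0 := by
  let f : ArithmeticFunction ℤ :=
    ⟨fun n => if n = 0 then 0 else 2 * fieldCount n + if n = 1 then 1 else 0, by simp⟩
  have hf : ∀ n ≠ 0, f n = 2 * fieldCount n + if n = 1 then 1 else 0 := fun n hn => by
    change (if n = 0 then (0 : ℤ) else _) = _
    rw [if_neg hn]
  have h : f * ζ = torsionFun := by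
    ext n
    rcases eq_or_ne n 0 with rfl | hn
    · simp
    rw [coe_mul_zeta_apply, torsionFun_apply hn, ← two_mul_sum_fieldCount_add_one hn,
      Finset.sum_congr rfl fun d hd => hf d (Nat.pos_of_mem_divisors hd).ne',
      Finset.sum_add_distrib, ← Finset.mul_sum, Finset.sum_ite_eq']
    simp [hn]
  rw [← hf n hn, charFun, ← h, mul_assoc]
  rw [coe_zeta_mul_moebius, mul_one]

theorem isMultiplicative_charFun : charFun.IsMultiplicative :=
  isMultiplicative_torsionFun.mul isMultiplicative_moebius

/-- The nontrivial Dirichlet character modulo `3`, as an arithmetic function. -/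
def chi : ArithmeticFunction ℤ :=
  ⟨fun n => if n % 3 = 1 then 1 else if n % 3 = 2 then -1 else 0, by simp⟩

theorem chi_apply (n : ℕ) : chi n = if n % 3 = 1 then 1 else if n % 3 = 2 then -1 else 0 := rfl

theorem chi_mul (m n : ℕ) : chi (m * n) = chi m * chi n := by
  simp only [chi_apply, Nat.mul_mod m n 3]
  have hm := Nat.mod_lt m three_pos
  have hn := Nat.mod_lt n three_pos
  interval_cases m % 3 <;> interval_cases n % 3 <;> simp

theorem isMultiplicative_chi : chi.IsMultiplicative :=
  ⟨by simp [chi_apply], fun _ => chi_mul _ _⟩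

/-- By complete multiplicativity χ factors out of the convolution, leaving χ·(ζ * μ). -/
theorem chi_mul_pmul_moebius : chi * (chi.pmul μ) = 1 := by
  ext n
  have h : (chi * (chi.pmul μ)) n = chi n * ((ζ : ArithmeticFunction ℤ) * μ) n := by
    rw [mul_apply, mul_apply, Finset.mul_sum]
    refine Finset.sum_congr rfl fun x hx => ?_
    obtain ⟨hx, hn⟩ := Nat.mem_divisorsAntidiagonal.1 hx
    have hx1 : x.1 ≠ 0 := by rintro h; simp [h] at hx; exact hn hx.symm
    rw [← hx, chi_mul]
    simp [hx1, mul_assoc]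
  rw [h, coe_zeta_mul_moebius]
  rcases eq_or_ne n 1 with rfl | hn
  · simp [chi_apply]
  · simp [one_apply_ne hn]

/-- The Dirichlet quotient of `charFun` by `ζ * χ`. -/
noncomputable def quotFun : ArithmeticFunction ℤ := charFun * μ * chi.pmul μ

theorem isMultiplicative_quotFun : quotFun.IsMultiplicative :=
  (isMultiplicative_charFun.mul isMultiplicative_moebius).mul
    (isMultiplicative_chi.pmul isMultiplicative_moebius)

theorem quotFun_mul : quotFun * (chi * ζ) = charFun := by
  rw [quotFun, mul_assoc, ← mul_assoc (chi.pmul μ), mul_comm (chi.pmul μ) chi,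
    chi_mul_pmul_moebius, one_mul, mul_assoc, moebius_mul_coe_zeta, mul_one]

theorem mul_apply_prime_pow_succ {f m : ArithmeticFunction ℤ} {p : ℕ} (hp : p.Prime)
    (hm1 : m 1 = 1) (hm : ∀ k, 2 ≤ k → m (p ^ k) = 0) (k : ℕ) :
    (f * m) (p ^ (k + 1)) = f (p ^ (k + 1)) + m p * f (p ^ k) := by
  rw [mul_apply, Nat.sum_divisorsAntidiagonal' (f := fun a b => f a * m b),
    Nat.sum_divisors_prime_pow hp, Finset.sum_range_succ', Finset.sum_range_succ',
    Finset.sum_eq_zero]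
  · have : p ^ (k + 1) / p = p ^ k := by
      rw [pow_succ, Nat.mul_div_cancel _ hp.pos]
    simp only [zero_add, pow_zero, Nat.div_one, hm1, pow_one, this, mul_one]
    ring
  · intro i _
    rw [hm _ (by omega), mul_zero]

theorem mul_moebius_apply_prime_pow_succ (f : ArithmeticFunction ℤ) {p : ℕ} (hp : p.Prime) (k : ℕ) :
    (f * μ) (p ^ (k + 1)) = f (p ^ (k + 1)) - f (p ^ k) := by
  rw [mul_apply_prime_pow_succ hp (by simp) _ k, moebius_apply_prime hp]
  · ring
  · intro k hk
    rw [moebius_apply_prime_pow hp (by omega), if_neg (by omega)]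

theorem mul_pmul_moebius_apply_prime_pow_succ (f : ArithmeticFunction ℤ) {p : ℕ} (hp : p.Prime)
    (k : ℕ) : (f * chi.pmul μ) (p ^ (k + 1)) = f (p ^ (k + 1)) - chi p * f (p ^ k) := by
  rw [mul_apply_prime_pow_succ hp (by simp [chi_apply]) _ k, pmul_apply, moebius_apply_prime hp]
  · ring
  · intro k hk
    rw [pmul_apply, moebius_apply_prime_pow hp (by omega), if_neg (by omega), mul_zero]

theorem torsionFun_prime_pow {p : ℕ} (hp : p.Prime) {k : ℕ} (hk : k ≠ 0) :
    torsionFun (p ^ k) = if p % 3 = 1 ∨ (p = 3 ∧ 2 ≤ k) then 3 else 1 := by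
  rw [torsionFun_apply (pow_ne_zero k hp.ne_zero), cubeTorsion_prime_pow hp hk]
  split_ifs <;> rfl

theorem charFun_prime_pow {p : ℕ} (hp : p.Prime) {k : ℕ} (hk : k ≠ 0) :
    charFun (p ^ k) = if (p % 3 = 1 ∧ k = 1) ∨ (p = 3 ∧ k = 2) then 2 else 0 := by
  obtain ⟨k, rfl⟩ := Nat.exists_eq_succ_of_ne_zero hk
  rw [charFun, Nat.succ_eq_add_one, mul_moebius_apply_prime_pow_succ _ hp,
    torsionFun_prime_pow hp k.succ_ne_zero]
  rcases Nat.eq_zero_or_pos k with rfl | hk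
  · rw [pow_zero, isMultiplicative_torsionFun.1]
    simp
    split_ifs <;> rfl
  · rw [torsionFun_prime_pow hp hk.ne']
    by_cases h1 : p % 3 = 1
    · have : p ≠ 3 := by rintro rfl; simp at h1
      simp [h1, this, hk.ne']
    · by_cases h3 : p = 3
      · subst h3
        by_cases h2 : k = 1
        · simp [h2]
        · have : 2 ≤ k := by omega
          have : 2 ≤ k + 1 := by omega
          simp [*]
      · simp [h1, h3]

/-- The values of `quotFun` at prime powers. -/
theorem quotFun_prime_pow {p : ℕ} (hp : p.Prime) (k : ℕ) :
    quotFun (p ^ k) =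
      if k = 0 then 1 else
      if p = 3 then (if k = 1 then -1 else if k = 2 then 2 else if k = 3 then -2 else 0) else
      if p % 3 = 1 then (if k = 2 then -3 else if k = 3 then 2 else 0) else
        if k = 2 then -1 else 0 := by
  -- As power series in X = p⁻ˢ the local factors are (1 + 2X²)(1 - X) at 3, (1 + 2X)(1 - X)² for p
  -- ≡ 1 mod 3, and (1 - X)(1 + X) for p ≡ 2 mod 3.
  have hb : ∀ k : ℕ, (charFun * μ) (p ^ (k + 1)) = charFun (p ^ (k + 1)) - charFun (p ^ k) :=
    mul_moebius_apply_prime_pow_succ _ hp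
  have hb0 : (charFun * μ) 1 = 1 := (isMultiplicative_charFun.mul isMultiplicative_moebius).1
  have h3 : p = 3 ∨ (p % 3 = 1 ∧ p ≠ 3) ∨ (p % 3 = 2 ∧ p ≠ 3) := by
    have h := Nat.prime_dvd_prime_iff_eq Nat.prime_three hp
    omega
  have hg : ∀ k : ℕ, quotFun (p ^ (k + 1)) = (charFun * μ) (p ^ (k + 1)) -
    chi p * (charFun * μ) (p ^ k) := mul_pmul_moebius_apply_prime_pow_succ _ hp
  have hc0 : charFun 1 = 1 := isMultiplicative_charFun.1
  rcases k with _ | _ | _ | k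
  · simp [isMultiplicative_quotFun.1]
  · rw [hg, hb, charFun_prime_pow hp (by omega), chi_apply, pow_zero, hb0, hc0]
    rcases h3 with rfl | ⟨h1, h2⟩ | ⟨h1, h2⟩ <;> simp [*]
  · rw [hg, hb, hb, charFun_prime_pow hp (by omega), charFun_prime_pow hp (by omega), chi_apply,
      pow_zero, hc0]
    rcases h3 with rfl | ⟨h1, h2⟩ | ⟨h1, h2⟩ <;> simp [*]
  · rw [hg, hb, hb, charFun_prime_pow hp (by omega), charFun_prime_pow hp (by omega),
      charFun_prime_pow hp (by omega), chi_apply]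
    rcases h3 with rfl | ⟨h1, h2⟩ | ⟨h1, h2⟩ <;> rcases k with _ | k <;> simp [*]

end CyclicCubic

namespace CyclicCubic

open ArithmeticFunction Finset Filter Topology
open scoped ArithmeticFunction.zeta ArithmeticFunction.Moebius

/-! ### The value L(1, χ) = π/(3√3) -/

section LValue

/-- Regroups L(1, χ) into the partial fractions of π cot(πx) at x = 1/3; the last term is the
boundary mismatch of the two groupings. -/
theorem sum_range_cot_eq (M : ℕ) :
    ∑ k ∈ range M, (1 / (3 * (k : ℝ) + 1) - 1 / (3 * (k : ℝ) + 2)) =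
      1 + (∑ j ∈ range M, (1 / ((1 / 3 : ℝ) - (j + 1)) + 1 / ((1 / 3 : ℝ) + (j + 1)))) / 3 -
        1 / (3 * (M : ℝ) + 1) := by
  induction M with
  | zero => simp
  | succ M ih =>
    rw [sum_range_succ, sum_range_succ, ih]
    have h1 : (3 * (M : ℝ) + 1) ≠ 0 := by positivity
    have h2 : (3 * (M : ℝ) + 2) ≠ 0 := by positivity
    have h3 : (3 * (M : ℝ) + 4) ≠ 0 := by positivity
    have h4 : (1 / 3 : ℝ) - (M + 1) = -(3 * M + 2) / 3 := by ring
    have h5 : (1 / 3 : ℝ) + (M + 1) = (3 * M + 4) / 3 := by ring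
    have h6 : 3 * ((M + 1 : ℕ) : ℝ) + 1 = 3 * M + 4 := by push_cast; ring
    rw [h4, h5, h6]
    field_simp
    ring

theorem tendsto_sum_range_chi :
    Tendsto (fun M : ℕ => ∑ k ∈ range M, (1 / (3 * (k : ℝ) + 1) - 1 / (3 * (k : ℝ) + 2))) atTop
      (𝓝 (Real.pi / (3 * √3))) := by
  have hx : ((1 / 3 : ℝ) : ℂ) ∈ Complex.integerComplement := by
    rintro ⟨n, hn⟩
    have h1 : (n : ℝ) = 1 / 3 := by exact_mod_cast hn
    have h2 : (3 * n : ℝ) = 1 := by rw [h1]; norm_num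
    have h3 : 3 * n = 1 := by exact_mod_cast h2
    omega
  have h := tendsto_logDeriv_euler_cot_sub hx
  have h1 := (Complex.continuous_re.tendsto _).comp h
  have h2 : Tendsto (fun M : ℕ =>
      ∑ j ∈ range M, (1 / ((1 / 3 : ℝ) - (j + 1)) + 1 / ((1 / 3 : ℝ) + (j + 1)))) atTop
      (𝓝 (Real.pi * Real.cot (Real.pi / 3) - 3)) := by
    convert h1 using 2
    · simp only [Function.comp, cotTerm]
      rw [← Complex.ofReal_re (∑ j ∈ range _, _)]
      push_cast
      rfl
    · rw [← Complex.ofReal_re (_ - 3)]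
      push_cast
      congr 3
      · ring_nf
      · norm_num
  have h3 : Tendsto (fun M : ℕ => 1 / (3 * (M : ℝ) + 1)) atTop (𝓝 0) := by
    refine tendsto_const_nhds.div_atTop (tendsto_atTop_add_const_right _ _ ?_)
    exact tendsto_natCast_atTop_atTop.const_mul_atTop three_pos
  have h4 := ((h2.div_const 3).const_add 1).sub h3
  have h5 : 1 + (Real.pi * Real.cot (Real.pi / 3) - 3) / 3 - 0 = Real.pi / (3 * √3) := by
    rw [Real.cot_eq_cos_div_sin, Real.cos_pi_div_three, Real.sin_pi_div_three]
    have : √3 ≠ 0 := by positivity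
    field_simp
    ring
  rw [h5] at h4
  exact h4.congr fun M => (sum_range_cot_eq M).symm

end LValue

/-! ### The summatory function of χ * ζ -/

section Hyperbola

/-- Each term is nonnegative and at most w(3k+1) - w(3k+4), which telescopes. -/
theorem sum_Ico_alternating_mem {w : ℕ → ℝ} (hw : ∀ i j, 0 < i → i ≤ j → w j ≤ w i)
    (K M : ℕ) (hKM : K ≤ M) : 0 ≤ ∑ k ∈ Ico K M, (w (3 * k + 1) - w (3 * k + 2)) ∧
      ∑ k ∈ Ico K M, (w (3 * k + 1) - w (3 * k + 2)) ≤ w (3 * K + 1) - w (3 * M + 1) := by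
  induction M, hKM using Nat.le_induction with
  | base => simp
  | succ M hKM ih =>
    rw [sum_Ico_succ_top hKM]
    have h1 := hw (3 * M + 1) (3 * M + 2) (by omega) (by omega)
    have h2 := hw (3 * M + 2) (3 * (M + 1) + 1) (by omega) (by omega)
    constructor <;> linarith

/-- The summatory function of `χ * ζ`. -/
noncomputable def chiSum (N : ℕ) : ℤ := ∑ n ∈ Ioc 0 N, (chi * ζ) n

theorem sum_range_chi_mul (F : ℕ → ℤ) (M : ℕ) :
    ∑ a ∈ range (3 * M), chi a * F a = ∑ k ∈ range M, (F (3 * k + 1) - F (3 * k + 2)) := by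
  induction M with
  | zero => simp
  | succ M ih =>
    rw [mul_add, mul_one, sum_range_succ, sum_range_succ, sum_range_succ, sum_range_succ, ih]
    have h0 : chi (3 * M) = 0 := by simp [chi_apply]
    have h1 : chi (3 * M + 1) = 1 := by simp [chi_apply, Nat.add_mod]
    have h2 : chi (3 * M + 2) = -1 := by simp [chi_apply, Nat.add_mod]
    rw [h0, h1, h2]
    ring

theorem chiSum_eq {N M : ℕ} (h : N < 3 * M) :
    chiSum N = ∑ k ∈ range M, (((N / (3 * k + 1) : ℕ) : ℤ) - ((N / (3 * k + 2) : ℕ) : ℤ)) := by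
  rw [← sum_range_chi_mul (fun a => ((N / a : ℕ) : ℤ)), chiSum, sum_Ioc_mul_zeta_eq_sum]
  refine sum_subset (fun a ha => ?_) (fun a _ ha => ?_)
  · have := (mem_Ioc.1 ha).2
    exact mem_range.2 (by omega)
  · rcases Nat.eq_zero_or_pos a with rfl | h0
    · simp
    · have : N < a := by
        by_contra h1
        exact ha (mem_Ioc.2 ⟨h0, by omega⟩)
      rw [Nat.div_eq_of_lt this]
      simp

theorem abs_natDiv_sub_le (N m : ℕ) (hm : 0 < m) :
    0 ≤ (N : ℝ) / m - (N / m : ℕ) ∧ (N : ℝ) / m - (N / m : ℕ) ≤ 1 := by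
  rw [← Nat.floor_div_eq_div (K := ℝ)]
  have h1 := Nat.floor_le (a := (N : ℝ) / m) (by positivity)
  have h2 := Nat.lt_floor_add_one ((N : ℝ) / m)
  constructor <;> linarith

/-- Compares ∑ χ(a)⌊N/a⌋ with ∑ χ(a)N/a. Each of the first K blocks mod 3 costs at most 1 from the
floors; both tails are alternating and lie in [0, N/(3K+1)]. -/
theorem abs_chiSum_sub_le (N K : ℕ) :
    |(chiSum N : ℝ) - Real.pi / (3 * √3) * N| ≤ K + N / (3 * K + 1) := by
  have h1 := (((tendsto_sum_range_chi.mul_const (N : ℝ)).const_sub (chiSum N : ℝ)).abs)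
  refine le_of_tendsto h1 ?_
  filter_upwards [eventually_ge_atTop (N + K + 1)] with M hM
  rw [chiSum_eq (show N < 3 * M by omega)]
  have hKM : K ≤ M := by omega
  rw [Int.cast_sum]
  simp only [Int.cast_sub, Int.cast_natCast]
  rw [sum_mul, ← sum_range_add_sum_Ico _ hKM, ← sum_range_add_sum_Ico (fun k : ℕ =>
    (1 / (3 * (k : ℝ) + 1) - 1 / (3 * (k : ℝ) + 2)) * (N : ℝ)) hKM]
  obtain ⟨a1, a2⟩ := sum_Ico_alternating_mem (w := fun i => ((N / i : ℕ) : ℝ))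
    (fun i j hi hij => by exact_mod_cast Nat.div_le_div_left hij hi)
    K M hKM
  obtain ⟨b1, b2⟩ := sum_Ico_alternating_mem (w := fun i => (N : ℝ) / i)
    (fun i j hi hij => by
      have : (0 : ℝ) < i := by exact_mod_cast hi
      gcongr)
    K M hKM
  have hc : |∑ k ∈ range K, (((N / (3 * k + 1) : ℕ) : ℝ) - ((N / (3 * k + 2) : ℕ) : ℝ)) -
      ∑ k ∈ range K, ((1 / (3 * (k : ℝ) + 1) - 1 / (3 * (k : ℝ) + 2)) * N)| ≤ K := by
    rw [← sum_sub_distrib]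
    refine (abs_sum_le_sum_abs _ _).trans ?_
    refine (sum_le_card_nsmul _ _ 1 fun k _ => ?_).trans (by simp)
    have e1 := abs_natDiv_sub_le N (3 * k + 1) (by omega)
    have e2 := abs_natDiv_sub_le N (3 * k + 2) (by omega)
    push_cast at e1 e2
    have e3 : (1 / (3 * (k : ℝ) + 1) - 1 / (3 * (k : ℝ) + 2)) * N =
      N / (3 * k + 1) - N / (3 * k + 2) := by ring
    rw [e3, abs_le]
    constructor <;> linarith
  have e4 : ∑ k ∈ Ico K M, ((1 / (3 * (k : ℝ) + 1) - 1 / (3 * (k : ℝ) + 2)) * N) =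
      ∑ k ∈ Ico K M, ((N : ℝ) / ((3 * k + 1 : ℕ) : ℝ) - N / ((3 * k + 2 : ℕ) : ℝ)) := by
    refine sum_congr rfl fun k _ => ?_
    push_cast
    ring
  rw [e4]
  have e8 : (N : ℝ) / ((3 * K + 1 : ℕ) : ℝ) = N / (3 * K + 1) := by push_cast; rfl
  have e5 : ((N / (3 * K + 1) : ℕ) : ℝ) ≤ N / (3 * K + 1) := by
    have := (abs_natDiv_sub_le N (3 * K + 1) (by omega)).1
    push_cast at this
    linarith
  have e6 : (0 : ℝ) ≤ ((N / (3 * M + 1) : ℕ) : ℝ) := by positivity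
  have e7 : (0 : ℝ) ≤ (N : ℝ) / ((3 * M + 1 : ℕ) : ℝ) := by positivity
  rw [abs_le] at hc ⊢
  constructor <;> linarith [hc.1, hc.2]

/-- For x ≥ 1, K ≈ √x gives an error at most 4√x. It is weakened to x^(2/3) so that the bound also
covers x < 1, where the sum is empty; this allows x = N/d with d > N later. -/
theorem abs_chiSum_floor_sub_le {x : ℝ} (hx : 0 < x) :
    |(chiSum ⌊x⌋₊ : ℝ) - Real.pi / (3 * √3) * x| ≤ 4 * x ^ (2 / 3 : ℝ) := by
  have hL0 : 0 ≤ Real.pi / (3 * √3) := by positivity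
  have hL : Real.pi / (3 * √3) ≤ 1 := by
    have h1 : 1.7 ≤ √3 := Real.le_sqrt_of_sq_le (by norm_num)
    rw [div_le_one (by positivity)]
    linarith [Real.pi_lt_d2]
  rcases lt_or_ge x 1 with h1 | h1
  · rw [Nat.floor_eq_zero.2 h1]
    have : x ≤ x ^ (2 / 3 : ℝ) := by
      conv_lhs => rw [← Real.rpow_one x]
      exact Real.rpow_le_rpow_of_exponent_ge hx h1.le (by norm_num)
    simp only [chiSum, Ioc_self, sum_empty, Int.cast_zero, zero_sub, abs_neg]
    rw [abs_of_nonneg (by positivity)]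
    nlinarith
  · set N := ⌊x⌋₊
    have hNx : (N : ℝ) ≤ x := Nat.floor_le hx.le
    have hxN : x < N + 1 := Nat.lt_floor_add_one x
    have h2 := abs_chiSum_sub_le N (Nat.sqrt N + 1)
    have h3 : ((Nat.sqrt N : ℕ) : ℝ) ≤ √x :=
      Real.nat_sqrt_le_real_sqrt.trans (Real.sqrt_le_sqrt hNx)
    have h4 : (N : ℝ) / (3 * ((Nat.sqrt N + 1 : ℕ) : ℝ) + 1) ≤ √x := by
      rw [div_le_iff₀ (by positivity)]
      have h5 : √x ≤ (Nat.sqrt N + 1 : ℕ) + 1 := by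
        have : √x ≤ √N + 1 := by
          rw [Real.sqrt_le_left (by positivity)]
          nlinarith [Real.sq_sqrt (Nat.cast_nonneg (α := ℝ) N), Real.sqrt_nonneg (N : ℝ)]
        have := Real.real_sqrt_le_nat_sqrt_succ (a := N)
        push_cast
        linarith
      have h6 : x = √x * √x := (Real.mul_self_sqrt hx.le).symm
      have h7 : 0 ≤ √x := Real.sqrt_nonneg x
      push_cast at h5 ⊢
      nlinarith [Nat.cast_nonneg (α := ℝ) (Nat.sqrt N)]
    have h8 : 1 ≤ √x := Real.one_le_sqrt.2 h1
    have h9 : √x ≤ x ^ (2 / 3 : ℝ) := by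
      rw [Real.sqrt_eq_rpow]
      exact Real.rpow_le_rpow_of_exponent_le h1 (by norm_num)
    push_cast at h2 h4
    rw [abs_le] at h2 ⊢
    have h10 : Real.pi / (3 * √3) * x - Real.pi / (3 * √3) * N ≤ 1 := by nlinarith
    have h11 : Real.pi / (3 * √3) * N ≤ Real.pi / (3 * √3) * x := by gcongr
    constructor <;> linarith [h2.1, h2.2]

end Hyperbola

end CyclicCubic

namespace CyclicCubic

open ArithmeticFunction Finset Filter Topology
open scoped ArithmeticFunction.zeta ArithmeticFunction.Moebius

/-! ### A summability criterion for multiplicative functions -/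

section EulerSummable

/-- Every 0 < n < N is N-smooth, so partial sums are bounded by the finite Euler product, hence by ∏
(1 + B p) ≤ exp(∑ B). -/
theorem summable_of_summable_primes {f : ℕ → ℝ} (hf0 : f 0 = 0) (hf1 : f 1 = 1)
    (hmul : ∀ {m n : ℕ}, m.Coprime n → f (m * n) = f m * f n) (hnn : ∀ n, 0 ≤ f n)
    (hsum : ∀ {p : ℕ}, p.Prime → Summable fun e => f (p ^ e)) {B : ℕ → ℝ} (hB : Summable B)
    (hB0 : ∀ n, 0 ≤ B n) (hfB : ∀ p : ℕ, p.Prime → ∑' e, f (p ^ e) ≤ 1 + B p) : Summable f := by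
  refine summable_of_sum_range_le (c := Real.exp (∑' n, B n)) hnn fun N => ?_
  obtain ⟨h1, h2⟩ := EulerProduct.summable_and_hasSum_smoothNumbers_prod_primesBelow_tsum hf1 hmul
    (fun hp => (hsum hp).norm) N
  have h3 : ∑ n ∈ range N, f n ≤ ∏ p ∈ N.primesBelow, ∑' e, f (p ^ e) := by
    rw [← h2.tsum_eq]
    have h4 : ∑ n ∈ range N, f n = ∑ n ∈ (range N).erase 0, f n := by
      rcases Nat.eq_zero_or_pos N with rfl | hN
      · simp
      · rw [← add_sum_erase _ _ (mem_range.2 hN), hf0, zero_add]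
    rw [h4]
    have h5 : ∀ n ∈ (range N).erase 0, n ∈ N.smoothNumbers := fun n hn => by
      rw [mem_erase, mem_range] at hn
      exact Nat.mem_smoothNumbers_of_lt (Nat.pos_of_ne_zero hn.1) hn.2
    rw [← sum_attach]
    have h6 := h2.summable.sum_le_tsum
      ((((range N).erase 0).attach).map ⟨fun n : {x // x ∈ (range N).erase 0} =>
        (⟨n.1, h5 n.1 n.2⟩ : N.smoothNumbers),
        fun a b hab => Subtype.ext (congrArg (fun z : N.smoothNumbers => z.1) hab)⟩)
      (fun i _ => hnn i)
    rw [sum_map] at h6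
    exact h6
  refine h3.trans ?_
  calc ∏ p ∈ N.primesBelow, ∑' e, f (p ^ e) ≤ ∏ p ∈ N.primesBelow, Real.exp (B p) := by
        refine prod_le_prod (fun p _ => tsum_nonneg fun e => hnn _) fun p hp => ?_
        refine (hfB p (Nat.prime_of_mem_primesBelow hp)).trans ?_
        rw [add_comm]
        exact Real.add_one_le_exp _
    _ = Real.exp (∑ p ∈ N.primesBelow, B p) := (Real.exp_sum _ _).symm
    _ ≤ _ := Real.exp_le_exp.2 (hB.sum_le_tsum _ fun i _ => hB0 i)

end EulerSummable

/-! ### Convergence and value of the quotient series at 1 -/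

section Quotient

theorem abs_quotFun_prime_pow_le {p : ℕ} (hp : p.Prime) (k : ℕ) :
    |(quotFun (p ^ k) : ℝ)| ≤ 3 := by
  rw [quotFun_prime_pow hp]
  split_ifs <;> norm_num

theorem quotFun_prime_pow_eq_zero {p : ℕ} (hp : p.Prime) {k : ℕ} (hk : 4 ≤ k) :
    quotFun (p ^ k) = 0 := by
  rw [quotFun_prime_pow hp]
  split_ifs <;> omega

/-- The absolute value of `quotFun`, twisted by `n ^ (-2/3)`. -/
noncomputable def quotAbs (n : ℕ) : ℝ := |(quotFun n : ℝ)| * (n : ℝ) ^ (-(2 / 3) : ℝ)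

theorem quotAbs_nonneg (n : ℕ) : 0 ≤ quotAbs n := by unfold quotAbs; positivity

theorem summable_quotAbs : Summable quotAbs := by
  have hz : ∀ {p : ℕ}, p.Prime → ∀ e ∉ range 4, quotAbs (p ^ e) = 0 := fun hp e he => by
    rw [quotAbs, quotFun_prime_pow_eq_zero hp (by simpa using he)]
    simp
  -- Only the exponents 1, 2, 3 contribute, each at most 3p^(-4/3): the quotient vanishes at primes
  -- p ≠ 3, and p = 3 is checked by hand.
  refine summable_of_summable_primes (B := fun p => 9 * (p : ℝ) ^ (-(4 / 3) : ℝ))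
    (by simp [quotAbs]) (by simp [quotAbs, isMultiplicative_quotFun.1]) ?_ quotAbs_nonneg
    (fun hp => summable_of_ne_finset_zero (hz hp)) ?_ (fun n => by positivity) fun p hp => ?_
  · intro m n h
    simp only [quotAbs]
    rw [isMultiplicative_quotFun.2 h, Int.cast_mul, abs_mul, Nat.cast_mul,
      Real.mul_rpow (by positivity) (by positivity)]
    ring
  · exact (Real.summable_nat_rpow.2 (by norm_num)).mul_left 9
  · rw [tsum_eq_sum (hz hp)]
    have hp1 : (1 : ℝ) ≤ p := by exact_mod_cast hp.one_lt.le
    have hp0 : (0 : ℝ) < p := by linarith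
    have hpow : ∀ e : ℕ, 2 ≤ e → quotAbs (p ^ e) ≤ 3 * (p : ℝ) ^ (-(4 / 3) : ℝ) := by
      intro e he
      refine mul_le_mul (abs_quotFun_prime_pow_le hp e) ?_ (by positivity) (by norm_num)
      rw [Nat.cast_pow, ← Real.rpow_natCast, ← Real.rpow_mul hp0.le]
      refine Real.rpow_le_rpow_of_exponent_le hp1 ?_
      have : (2 : ℝ) ≤ e := by exact_mod_cast he
      linarith
    have h1 : quotAbs (p ^ 1) ≤ 3 * (p : ℝ) ^ (-(4 / 3) : ℝ) := by
      rw [quotAbs, quotFun_prime_pow hp]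
      by_cases h3 : p = 3
      · subst h3
        have : ((3 : ℕ) : ℝ) ^ (-(2 / 3) : ℝ) ≤ 3 * ((3 : ℕ) : ℝ) ^ (-(4 / 3) : ℝ) := by
          have : (3 : ℝ) * (3 : ℝ) ^ (-(4 / 3) : ℝ) = 3 ^ (1 + -(4 / 3) : ℝ) := by
            rw [Real.rpow_add three_pos, Real.rpow_one]
          push_cast
          rw [this]
          exact Real.rpow_le_rpow_of_exponent_le (by norm_num) (by norm_num)
        simpa using this
      · simp [h3]
        positivity
    have h0 : quotAbs (p ^ 0) = 1 := by simp [quotAbs, isMultiplicative_quotFun.1]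
    simp only [sum_range_succ, sum_range_zero, h0]
    have h2 := hpow 2 le_rfl
    have h3 := hpow 3 (by norm_num)
    linarith

theorem abs_quotFun_div_le (n : ℕ) : |(quotFun n : ℝ) / n| ≤ quotAbs n := by
  rcases Nat.eq_zero_or_pos n with rfl | hn
  · simp [quotAbs]
  · have hn1 : (1 : ℝ) ≤ n := by exact_mod_cast hn
    rw [abs_div, quotAbs, div_eq_mul_inv, Nat.abs_cast, ← Real.rpow_neg_one]
    refine mul_le_mul_of_nonneg_left ?_ (abs_nonneg _)
    exact Real.rpow_le_rpow_of_exponent_le hn1 (by norm_num)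

theorem summable_quotFun_div : Summable fun n : ℕ => ‖(quotFun n : ℝ) / n‖ :=
  summable_quotAbs.of_nonneg_of_le (fun _ => norm_nonneg _) abs_quotFun_div_le

theorem summable_two_div : Summable fun p : PrimeOneModThree =>
    2 / ((p.1 : ℝ) * ((p.1 : ℝ) + 1)) := by
  have h : Summable fun n : ℕ => 2 * (1 / (n : ℝ) ^ 2) :=
    (Real.summable_one_div_nat_pow.2 one_lt_two).mul_left 2
  refine Summable.of_nonneg_of_le (fun p => by positivity) (fun p => ?_)
    (h.comp_injective Subtype.val_injective)
  have : (0 : ℝ) < p.1 := by exact_mod_cast p.2.1.pos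
  simp only [Function.comp]
  rw [mul_one_div]
  gcongr
  nlinarith

theorem multipliable_primeOneModThree : Multipliable fun p : PrimeOneModThree =>
    (1 : ℝ) - 2 / ((p.1 : ℝ) * ((p.1 : ℝ) + 1)) := by
  simp only [sub_eq_add_neg]
  exact Real.multipliable_one_add_of_summable summable_two_div.neg

/-- A product over all primes whose factors are trivial outside `3` and the primes `1` mod `3`. -/
theorem hasProd_primes {R : Type*} [CommMonoid R] [TopologicalSpace R] [ContinuousMul R]
    {F : ℕ → R} {P c : R} (hP : HasProd (fun p : PrimeOneModThree => F p.1) P) (h3 : F 3 = c)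
    (hF : ∀ p : ℕ, p.Prime → p % 3 = 2 → F p = 1) :
    HasProd (fun p : Nat.Primes => F p) (c * P) := by
  let i : PrimeOneModThree → Nat.Primes := fun p => ⟨p.1, p.2.1⟩
  have hi : Function.Injective i := fun a b h =>
    Subtype.ext (congrArg (fun z : Nat.Primes => z.1) h)
  have h1 : HasProd (fun p : Nat.Primes => if p.1 % 3 = 1 then F p else 1) P := by
    rw [← hi.hasProd_iff]
    · convert hP using 2 with p
      change (if p.1 % 3 = 1 then F p.1 else 1) = F p.1
      rw [if_pos p.2.2]
    · intro p hp
      rw [if_neg]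
      exact fun h => hp ⟨⟨p.1, p.2, h⟩, rfl⟩
  have h2 : HasProd (fun p : Nat.Primes => if p.1 = 3 then F p else 1) c := by
    convert hasProd_single (f := fun p : Nat.Primes => if p.1 = 3 then F p else 1)
      (⟨3, Nat.prime_three⟩ : Nat.Primes) ?_ using 1
    · simp [h3]
    · intro p hp
      rw [if_neg]
      exact fun h => hp (Subtype.ext h)
  convert h2.mul h1 using 2 with p
  have h := Nat.prime_dvd_prime_iff_eq Nat.prime_three p.2
  have h' : p.1 % 3 = 2 → F p = 1 := hF p.1 p.2
  have : p.1 = 3 ∨ (p.1 % 3 = 1 ∧ p.1 ≠ 3) ∨ (p.1 % 3 = 2 ∧ p.1 ≠ 3) := by omega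
  rcases this with h1 | ⟨h1, h2⟩ | ⟨h1, h2⟩
  · simp [h1]
  · simp [h1, h2]
  · simp [h1, h2, h' h1]

theorem hasProd_one_sub_inv_sq : HasProd (fun p : Nat.Primes => 1 - 1 / ((p : ℕ) : ℝ) ^ 2)
    (6 / Real.pi ^ 2) := by
  let f : ℕ →*₀ ℝ :=
    { toFun := fun n => 1 / (n : ℝ) ^ 2
      map_zero' := by simp
      map_one' := by simp
      map_mul' := fun m n => by push_cast; rw [mul_pow, one_div_mul_one_div] }
  have hs : Summable fun n => ‖f n‖ := hasSum_zeta_two.summable.norm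
  have h := (EulerProduct.eulerProduct_completely_multiplicative_hasProd hs).inv₀
    (by rw [show ∑' n, f n = Real.pi ^ 2 / 6 from hasSum_zeta_two.tsum_eq]; positivity)
  rw [show ∑' n, f n = Real.pi ^ 2 / 6 from hasSum_zeta_two.tsum_eq, inv_div] at h
  simp only [inv_inv] at h
  exact h

/-- Each local factor is 1 - p⁻² times a correction: 11/12 at 3, 1 - 2/(p(p+1)) for p ≡ 1 mod 3, and
1 for p ≡ 2 mod 3. The factors 1 - p⁻² multiply to 1/ζ(2) = 6/π². -/
theorem tsum_quotFun_div : ∑' n : ℕ, (quotFun n : ℝ) / n =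
    11 / (2 * Real.pi ^ 2) * ∏' p : PrimeOneModThree, (1 - 2 / ((p.1 : ℝ) * ((p.1 : ℝ) + 1))) := by
  have h1 : HasProd (fun p : Nat.Primes => ∑' e : ℕ, (quotFun (p ^ e) : ℝ) / ((p ^ e : ℕ) : ℝ))
      (∑' n : ℕ, (quotFun n : ℝ) / n) := by
    refine EulerProduct.eulerProduct_hasProd (f := fun n : ℕ => (quotFun n : ℝ) / n)
      (by simp [isMultiplicative_quotFun.1]) ?_ summable_quotFun_div (by simp)
    intro m n h
    rw [isMultiplicative_quotFun.2 h]
    push_cast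
    rw [mul_div_mul_comm]
  let F : ℕ → ℝ := fun p => if p = 3 then 11 / 12 else if p % 3 = 1 then
    1 - 2 / ((p : ℝ) * ((p : ℝ) + 1)) else 1
  have h2 : HasProd (fun p : Nat.Primes => F p) (11 / 12 *
      ∏' p : PrimeOneModThree, (1 - 2 / ((p.1 : ℝ) * ((p.1 : ℝ) + 1)))) := by
    refine hasProd_primes ?_ (by simp [F]) ?_
    · convert multipliable_primeOneModThree.hasProd using 2 with p
      have : p.1 ≠ 3 := by rintro h; have := p.2.2; simp [h] at this
      simp [F, this, p.2.2]
    · intro p _ h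
      have : p ≠ 3 := by rintro rfl; simp at h
      simp [F, this, h]
  have h3 := hasProd_one_sub_inv_sq.mul h2
  have h4 : (fun p : Nat.Primes => ∑' e : ℕ, (quotFun (p ^ e) : ℝ) / ((p ^ e : ℕ) : ℝ)) =
      fun p : Nat.Primes => (1 - 1 / ((p : ℕ) : ℝ) ^ 2) * F p := by
    funext p
    obtain ⟨p, hp⟩ := p
    change ∑' e : ℕ, (quotFun (p ^ e) : ℝ) / ((p ^ e : ℕ) : ℝ) = (1 - 1 / (p : ℝ) ^ 2) * F p
    rw [tsum_eq_sum (s := range 4) fun e he => by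
      rw [quotFun_prime_pow_eq_zero hp (by simpa using he)]; simp]
    simp only [sum_range_succ, sum_range_zero, quotFun_prime_pow hp, F]
    have hp0 : (p : ℝ) ≠ 0 := by exact_mod_cast hp.ne_zero
    have hp1 : (p : ℝ) + 1 ≠ 0 := by positivity
    by_cases hp3 : p = 3
    · subst hp3
      norm_num
    · by_cases h : p % 3 = 1
      · simp [hp3, h]
        field_simp
        ring
      · simp [hp3, h]
        ring
  rw [h4] at h1
  rw [h1.unique h3]
  have : Real.pi ≠ 0 := Real.pi_ne_zero
  field_simp
  ring

end Quotient

/-! ### Partial sums of the character count -/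

section Asymptotic

/-- The sum is ∑ q(d)·`chiSum`(N/d), q being `quotFun`. Both it and its main term are taken over all
d, so the error is bounded termwise by 4|q(d)|(N/d)^(2/3). -/
theorem abs_sum_charFun_sub_le {N : ℕ} (hN : 0 < N) :
    |((∑ n ∈ Ioc 0 N, charFun n : ℤ) : ℝ) -
      Real.pi / (3 * √3) * (∑' n : ℕ, (quotFun n : ℝ) / n) * N| ≤
      4 * (∑' n, quotAbs n) * (N : ℝ) ^ (2 / 3 : ℝ) := by
  have hN0 : (0 : ℝ) < N := by exact_mod_cast hN
  have h1 : HasSum (fun d : ℕ => (quotFun d : ℝ) * chiSum (N / d))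
      ((∑ n ∈ Ioc 0 N, charFun n : ℤ) : ℝ) := by
    rw [← quotFun_mul, sum_Ioc_mul_eq_sum_sum]
    push_cast
    have h : ∀ d ∉ Ioc 0 N, (quotFun d : ℝ) * chiSum (N / d) = 0 := fun d hd => ?_
    · have h' := hasSum_sum_of_ne_finset_zero (L := .unconditional ℕ) h
      simp only [chiSum, Int.cast_sum] at h' ⊢
      exact h'
    rcases Nat.eq_zero_or_pos d with rfl | hd0
    · simp
    · have : N < d := by
        by_contra h
        exact hd (mem_Ioc.2 ⟨hd0, by omega⟩)
      rw [Nat.div_eq_of_lt this]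
      simp [chiSum]
  have h2 : HasSum (fun d : ℕ => (quotFun d : ℝ) * (Real.pi / (3 * √3) * (N / d)))
      (Real.pi / (3 * √3) * (∑' n : ℕ, (quotFun n : ℝ) / n) * N) := by
    refine ((summable_quotFun_div.of_norm.hasSum.mul_left (Real.pi / (3 * √3))).mul_right
      (N : ℝ)).congr_fun fun d => ?_
    ring
  have h3 := h1.sub h2
  rw [← h3.tsum_eq]
  have h4 : ∀ d : ℕ, ‖(quotFun d : ℝ) * chiSum (N / d) -
      (quotFun d : ℝ) * (Real.pi / (3 * √3) * (N / d))‖ ≤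
      4 * quotAbs d * (N : ℝ) ^ (2 / 3 : ℝ) := by
    intro d
    rcases Nat.eq_zero_or_pos d with rfl | hd0
    · simp [quotAbs]
    · have hd : (0 : ℝ) < d := by exact_mod_cast hd0
      have h := abs_chiSum_floor_sub_le (x := (N : ℝ) / d) (by positivity)
      rw [Nat.floor_div_eq_div] at h
      rw [← mul_sub, norm_mul, Real.norm_eq_abs, Real.norm_eq_abs]
      refine (mul_le_mul_of_nonneg_left h (abs_nonneg _)).trans (le_of_eq ?_)
      rw [quotAbs, Real.div_rpow hN0.le hd.le, Real.rpow_neg hd.le]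
      ring
  have h5 := tsum_of_norm_bounded
    (((summable_quotAbs.hasSum.mul_left 4).mul_right ((N : ℝ) ^ (2 / 3 : ℝ)))) h4
  exact h5

end Asymptotic

end CyclicCubic

namespace CyclicCubic

open ArithmeticFunction Finset Filter Topology

/-! ### The counting function -/

section Counting

theorem setOf_conductor_le_eq {X : ℝ} (hX : 0 ≤ X) :
    {K : CyclicCubicField | (conductor K.1 : ℝ) ≤ X} =
      {K : CyclicCubicField | conductor K.1 ∈ Ioc 0 ⌊X⌋₊} := by
  ext K
  simp only [Set.mem_ofPred_eq, mem_Ioc, Nat.le_floor_iff hX, (conductor_spec K).1, true_and]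

theorem finite_setOf_conductor_le (X : ℝ) :
    {K : CyclicCubicField | (conductor K.1 : ℝ) ≤ X}.Finite := by
  rcases lt_or_ge X 0 with hX | hX
  · convert Set.finite_empty
    ext K
    have : (0 : ℝ) ≤ conductor K.1 := Nat.cast_nonneg _
    simp only [Set.mem_ofPred_eq, Set.mem_empty_iff_false, iff_false, not_le]
    linarith
  · rw [setOf_conductor_le_eq hX]
    exact finite_conductor_mem _

theorem two_mul_countingFunction_add_one {X : ℝ} (hX : 1 ≤ X) :
    2 * (countingFunction X : ℝ) + 1 = ((∑ n ∈ Ioc 0 ⌊X⌋₊, charFun n : ℤ) : ℝ) := by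
  have h1 : 1 ∈ Ioc 0 ⌊X⌋₊ := mem_Ioc.2 ⟨one_pos, Nat.le_floor (by simpa using hX)⟩
  rw [countingFunction, setOf_conductor_le_eq (by linarith), ncard_conductor_mem,
    sum_congr rfl fun n hn => charFun_eq n (mem_Ioc.1 hn).1.ne', sum_add_distrib, ← mul_sum,
    sum_ite_eq' _ _ _, if_pos h1]
  push_cast
  rfl

theorem leadingConstant_eq :
    leadingConstant = 1 / 2 * (Real.pi / (3 * √3) * ∑' n : ℕ, (quotFun n : ℝ) / n) := by
  rw [leadingConstant, tsum_quotFun_div]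
  have h3 : √3 * √3 = 3 := Real.mul_self_sqrt (by norm_num)
  have h0 : √3 ≠ 0 := by positivity
  have hp : Real.pi ≠ 0 := Real.pi_ne_zero
  generalize (∏' p : PrimeOneModThree, (1 - 2 / ((p.1 : ℝ) * ((p.1 : ℝ) + 1)))) = P
  field_simp
  linear_combination 12 * P * h3

/-- The error is in fact bounded by a multiple of X^(2/3) plus a constant; the constant absorbs the
rounding of X and the trivial character. -/
theorem isBigO_countingFunction_sub {ε : ℝ} (hε : 0 < ε) :
    (fun X : ℝ => (countingFunction X : ℝ) - leadingConstant * X)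
      =O[atTop] (fun X : ℝ => X ^ (2 / 3 + ε)) := by
  refine Asymptotics.IsBigO.of_bound (2 * (∑' n, quotAbs n) + |leadingConstant| + 1) ?_
  filter_upwards [eventually_ge_atTop 1] with X hX
  have hX0 : 0 ≤ X := by linarith
  have hfl : 0 < ⌊X⌋₊ := Nat.floor_pos.2 hX
  have hq : 0 ≤ ∑' n, quotAbs n := tsum_nonneg quotAbs_nonneg
  have h1 := abs_sum_charFun_sub_le hfl
  rw [← two_mul_countingFunction_add_one hX] at h1
  have hL : Real.pi / (3 * √3) * ∑' n : ℕ, (quotFun n : ℝ) / n = 2 * leadingConstant := by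
    rw [leadingConstant_eq]
    ring
  rw [hL] at h1
  have hY : (⌊X⌋₊ : ℝ) ^ (2 / 3 : ℝ) ≤ X ^ (2 / 3 + ε) :=
    (Real.rpow_le_rpow (by positivity) (Nat.floor_le hX0) (by norm_num)).trans
      (Real.rpow_le_rpow_of_exponent_le hX (by linarith))
  have hY1 : 1 ≤ X ^ (2 / 3 + ε) := Real.one_le_rpow hX (by positivity)
  have h2 : |leadingConstant * (X - ⌊X⌋₊)| ≤ |leadingConstant| := by
    rw [abs_mul]
    refine mul_le_of_le_one_right (abs_nonneg _) (abs_le.2 ⟨?_, ?_⟩)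
    · linarith [Nat.floor_le hX0]
    · linarith [Nat.lt_floor_add_one X]
  have h3 : (countingFunction X : ℝ) - leadingConstant * X =
      1 / 2 * (2 * (countingFunction X : ℝ) + 1 - 2 * leadingConstant * ⌊X⌋₊) -
        leadingConstant * (X - ⌊X⌋₊) - 1 / 2 := by ring
  have h4 : |(countingFunction X : ℝ) - leadingConstant * X| ≤
      1 / 2 * (4 * (∑' n, quotAbs n) * (⌊X⌋₊ : ℝ) ^ (2 / 3 : ℝ)) + |leadingConstant| + 1 / 2 := by
    rw [abs_le] at h1 h2 ⊢
    rw [h3]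
    constructor <;> linarith
  rw [Real.norm_eq_abs, Real.norm_of_nonneg (by linarith)]
  refine h4.trans ?_
  have h5 := mul_le_mul_of_nonneg_left hY hq
  have h6 := mul_le_mul_of_nonneg_left hY1 (abs_nonneg leadingConstant)
  linarith

end Counting

/-! ### The Dirichlet series and its Euler product -/

section DirichletSeries

theorem charFun_nonneg (n : ℕ) : 0 ≤ charFun n := by
  rcases eq_or_ne n 0 with rfl | hn
  · simp
  · rw [charFun_eq n hn]
    positivity

theorem charFun_prime_pow_eq_zero {p : ℕ} (hp : p.Prime) {k : ℕ} (hk : 3 ≤ k) :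
    charFun (p ^ k) = 0 := by
  rw [charFun_prime_pow hp (by omega), if_neg (by omega)]

theorem summable_charFun_rpow {σ : ℝ} (hσ : 1 < σ) :
    Summable fun n : ℕ => (charFun n : ℝ) * (n : ℝ) ^ (-σ) := by
  have hz : ∀ {p : ℕ}, p.Prime → ∀ e ∉ range 3,
      (charFun (p ^ e) : ℝ) * ((p ^ e : ℕ) : ℝ) ^ (-σ) = 0 := fun hp e he => by
    rw [charFun_prime_pow_eq_zero hp (by simpa using he)]
    simp
  have hnn : ∀ n : ℕ, 0 ≤ (charFun n : ℝ) * (n : ℝ) ^ (-σ) := fun n =>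
    mul_nonneg (by exact_mod_cast charFun_nonneg n) (by positivity)
  refine summable_of_summable_primes (B := fun p => 2 * (p : ℝ) ^ (-σ)) (by simp)
    (by simp [isMultiplicative_charFun.1]) ?_ hnn
    (fun hp => summable_of_ne_finset_zero (hz hp)) ?_ (fun n => by positivity) fun p hp => ?_
  · intro m n h
    rw [isMultiplicative_charFun.2 h, Int.cast_mul, Nat.cast_mul,
      Real.mul_rpow (by positivity) (by positivity)]
    ring
  · exact (Real.summable_nat_rpow.2 (by linarith)).mul_left 2
  · rw [tsum_eq_sum (hz hp)]
    have hp1 : (1 : ℝ) ≤ p := by exact_mod_cast hp.one_lt.le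
    have hle : ((p : ℝ) ^ 2) ^ (-σ) ≤ (p : ℝ) ^ (-σ) :=
      Real.rpow_le_rpow_of_nonpos (by linarith) (by nlinarith) (by linarith)
    have hpos : 0 ≤ (p : ℝ) ^ (-σ) := by positivity
    simp only [sum_range_succ, sum_range_zero, charFun_prime_pow hp one_ne_zero,
      charFun_prime_pow hp two_ne_zero]
    by_cases h : p % 3 = 1
    · have : p ≠ 3 := by rintro rfl; simp at h
      simp [h, this, isMultiplicative_charFun.1]
    · by_cases h3 : p = 3
      · subst h3
        norm_num at hle
        simpa [isMultiplicative_charFun.1] using hle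
      · simpa [h, h3, isMultiplicative_charFun.1] using hpos

variable {s : ℂ}

theorem norm_charFun_div (n : ℕ) (s : ℂ) :
    ‖(charFun n : ℂ) / (n : ℂ) ^ s‖ = (charFun n : ℝ) * (n : ℝ) ^ (-s.re) := by
  rcases Nat.eq_zero_or_pos n with rfl | hn
  · simp
  · rw [norm_div, Complex.norm_natCast_cpow_of_pos hn, Complex.norm_intCast,
      abs_of_nonneg (by exact_mod_cast charFun_nonneg n), Real.rpow_neg (by positivity),
      div_eq_mul_inv]

theorem multipliable_one_add_two_div (hs : 1 < s.re) :
    Multipliable fun p : PrimeOneModThree => 1 + 2 / (p.1 : ℂ) ^ s := by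
  refine Complex.multipliable_one_add_of_summable (Summable.of_norm ?_)
  have h : Summable fun n : ℕ => 2 * (n : ℝ) ^ (-s.re) :=
    (Real.summable_nat_rpow.2 (by linarith)).mul_left 2
  refine (h.comp_injective Subtype.val_injective).congr fun p => ?_
  simp only [Function.comp]
  rw [norm_div, Complex.norm_natCast_cpow_of_pos p.2.1.pos, Real.rpow_neg (by positivity),
    div_eq_mul_inv, Complex.norm_ofNat]

theorem hasSum_charFun_div (hs : 1 < s.re) :
    HasSum (fun n : ℕ => (charFun n : ℂ) / (n : ℂ) ^ s)
      ((1 + 2 / (3 : ℂ) ^ (2 * s)) * ∏' p : PrimeOneModThree, (1 + 2 / (p.1 : ℂ) ^ s)) := by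
  have hsum : Summable fun n : ℕ => ‖(charFun n : ℂ) / (n : ℂ) ^ s‖ := by
    simp only [norm_charFun_div]
    exact summable_charFun_rpow hs
  have h1 : HasProd (fun p : Nat.Primes =>
      ∑' e : ℕ, (charFun (p ^ e) : ℂ) / ((p ^ e : ℕ) : ℂ) ^ s)
      (∑' n : ℕ, (charFun n : ℂ) / (n : ℂ) ^ s) := by
    refine EulerProduct.eulerProduct_hasProd (f := fun n : ℕ => (charFun n : ℂ) / (n : ℂ) ^ s)
      (by simp [isMultiplicative_charFun.1]) ?_ hsum (by simp)
    intro m n h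
    rw [isMultiplicative_charFun.2 h, Nat.cast_mul, Complex.natCast_mul_natCast_cpow]
    push_cast
    rw [mul_div_mul_comm]
  let F : ℕ → ℂ := fun p => if p = 3 then 1 + 2 / (3 : ℂ) ^ (2 * s) else if p % 3 = 1 then
    1 + 2 / (p : ℂ) ^ s else 1
  have h2 : HasProd (fun p : Nat.Primes => F p) ((1 + 2 / (3 : ℂ) ^ (2 * s)) *
      ∏' p : PrimeOneModThree, (1 + 2 / (p.1 : ℂ) ^ s)) := by
    refine hasProd_primes ?_ (by simp [F]) ?_
    · convert (multipliable_one_add_two_div hs).hasProd using 2 with p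
      have : p.1 ≠ 3 := by rintro h; have := p.2.2; simp [h] at this
      simp [F, this, p.2.2]
    · intro p _ h
      have : p ≠ 3 := by rintro rfl; simp at h
      simp [F, this, h]
  have h4 : (fun p : Nat.Primes => ∑' e : ℕ, (charFun (p ^ e) : ℂ) / ((p ^ e : ℕ) : ℂ) ^ s) =
      fun p : Nat.Primes => F p := by
    funext p
    obtain ⟨p, hp⟩ := p
    change ∑' e : ℕ, (charFun (p ^ e) : ℂ) / ((p ^ e : ℕ) : ℂ) ^ s = F p
    rw [tsum_eq_sum (s := range 3) fun e he => by
      rw [charFun_prime_pow_eq_zero hp (by simpa using he)]; simp]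
    simp only [sum_range_succ, sum_range_zero, charFun_prime_pow hp one_ne_zero,
      charFun_prime_pow hp two_ne_zero, F]
    by_cases hp3 : p = 3
    · subst hp3
      have : (3 : ℂ) ^ (2 * s) = ((3 ^ 2 : ℕ) : ℂ) ^ s := by
        rw [sq, Nat.cast_mul, Complex.natCast_mul_natCast_cpow, two_mul,
          Complex.cpow_add _ _ (by norm_num)]
        norm_num
      rw [this]
      simp [isMultiplicative_charFun.1]
    · by_cases h : p % 3 = 1
      · simp [hp3, h, isMultiplicative_charFun.1]
      · simp [hp3, h, isMultiplicative_charFun.1]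
  rw [h4] at h1
  rw [← h1.unique h2]
  exact hsum.of_norm.hasSum

/-- Grouping a finite set of fields by conductor n gives at most `fieldCount n` ≤ `charFun n` terms
of size n^(-Re s). -/
theorem summable_one_div_conductor_cpow (hs : 1 < s.re) :
    Summable fun K : CyclicCubicField => 1 / (conductor K.1 : ℂ) ^ s := by
  refine Summable.of_norm ?_
  refine summable_of_sum_le (c := ∑' n : ℕ, (charFun n : ℝ) * (n : ℝ) ^ (-s.re))
    (fun _ => norm_nonneg _) fun u => ?_
  have hn : ∀ K : CyclicCubicField, ‖1 / (conductor K.1 : ℂ) ^ s‖ =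
      (conductor K.1 : ℝ) ^ (-s.re) := fun K => by
    rw [norm_div, Complex.norm_natCast_cpow_of_pos (conductor_spec K).1,
      Real.rpow_neg (by positivity), norm_one, one_div]
  classical
  have hnn : ∀ n : ℕ, 0 ≤ (charFun n : ℝ) * (n : ℝ) ^ (-s.re) := fun n =>
    mul_nonneg (by exact_mod_cast charFun_nonneg n) (by positivity)
  refine le_trans ?_ ((summable_charFun_rpow hs).sum_le_tsum
    (u.image fun K => conductor K.1) fun n _ => hnn n)
  simp only [hn]
  rw [← sum_fiberwise_of_maps_to (g := fun K : CyclicCubicField => conductor K.1)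
    (fun K hK => mem_image_of_mem (fun K : CyclicCubicField => conductor K.1) hK)]
  refine sum_le_sum fun n hn => ?_
  have h0 : n ≠ 0 := by
    obtain ⟨K, -, rfl⟩ := mem_image.1 hn
    exact (conductor_spec K).1.ne'
  rw [sum_congr rfl fun K hK => by rw [(mem_filter.1 hK).2], sum_const, nsmul_eq_mul]
  refine mul_le_mul_of_nonneg_right ?_ (by positivity)
  have h1 : #(u.filter fun K : CyclicCubicField => conductor K.1 = n) ≤ fieldCount n := by
    rw [← Set.ncard_coe_finset]
    exact Set.ncard_le_ncard (fun K hK => (mem_filter.1 hK).2) (finite_conductor_eq n)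
  have h2 : (fieldCount n : ℤ) ≤ charFun n := by
    rw [charFun_eq n h0]
    split_ifs <;> omega
  exact_mod_cast (Int.ofNat_le.2 h1).trans h2

/-- Summed along the fibres of the conductor; the number of fields of conductor n ≥ 1 is (h(n) - [n
= 1])/2, h being `charFun`, and the indicator produces the -1/2. -/
theorem hasSum_one_div_conductor_cpow (hs : 1 < s.re) :
    HasSum (fun K : CyclicCubicField => 1 / (conductor K.1 : ℂ) ^ s)
      (-1 / 2 + 1 / 2 * (1 + 2 / (3 : ℂ) ^ (2 * s)) *
        ∏' p : PrimeOneModThree, (1 + 2 / (p.1 : ℂ) ^ s)) := by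
  have hS := summable_one_div_conductor_cpow hs
  have h1 := ((Equiv.sigmaFiberEquiv fun K : CyclicCubicField => conductor K.1).hasSum_iff.2
    hS.hasSum).sigma (g := fun n : ℕ => (fieldCount n : ℂ) * (1 / (n : ℂ) ^ s)) fun n => by
      have : Finite {K : CyclicCubicField // conductor K.1 = n} := finite_conductor_eq n
      have := Fintype.ofFinite {K : CyclicCubicField // conductor K.1 = n}
      convert hasSum_fintype _ using 1
      rw [sum_congr rfl (g := fun _ => 1 / (n : ℂ) ^ s) fun K _ => by
        change 1 / (conductor K.1.1 : ℂ) ^ s = _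
        rw [K.2], sum_const, card_univ, nsmul_eq_mul, ← Nat.card_eq_fintype_card]
      rfl
  have h2 : HasSum (fun n : ℕ => (fieldCount n : ℂ) * (1 / (n : ℂ) ^ s))
      (1 / 2 * ((1 + 2 / (3 : ℂ) ^ (2 * s)) * ∏' p : PrimeOneModThree, (1 + 2 / (p.1 : ℂ) ^ s) -
        1)) := by
    refine (((hasSum_charFun_div hs).sub (hasSum_ite_eq 1 (1 : ℂ))).mul_left (1 / 2)).congr_fun
      fun n => ?_
    rcases eq_or_ne n 0 with rfl | hn
    -- At n = 0 both sides vanish, since 0ˢ = 0 for s ≠ 0 and division by zero gives 0.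
    · have : s ≠ 0 := by rintro rfl; simp at hs; linarith
      simp [this]
    · rw [charFun_eq n hn]
      split_ifs with h
      · subst h
        simp
      · push_cast
        ring
  convert hS.hasSum using 1
  rw [h1.unique h2]
  ring

end DirichletSeries

end CyclicCubic

theorem proposition7p1 :
    -- every cyclic cubic field has a conductor
    (∀ K : CyclicCubic.CyclicCubicField, ∃ n : ℕ, CyclicCubic.EmbedsInCyclotomic K.1 n) ∧
    -- the Dirichlet series and its Euler product
    (∀ s : ℂ, 1 < s.re →
      Multipliable (fun p : CyclicCubic.PrimeOneModThree => 1 + 2 / (p.1 : ℂ) ^ s) ∧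
      HasSum (fun K : CyclicCubic.CyclicCubicField => 1 / (CyclicCubic.conductor K.1 : ℂ) ^ s)
        (-1 / 2 + 1 / 2 * (1 + 2 / (3 : ℂ) ^ (2 * s)) *
          ∏' p : CyclicCubic.PrimeOneModThree, (1 + 2 / (p.1 : ℂ) ^ s))) ∧
    -- the counting function
    (∀ X : ℝ,
      {K : CyclicCubic.CyclicCubicField | (CyclicCubic.conductor K.1 : ℝ) ≤ X}.Finite) ∧
    Multipliable (fun p : CyclicCubic.PrimeOneModThree =>
      (1 : ℝ) - 2 / ((p.1 : ℝ) * ((p.1 : ℝ) + 1))) ∧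
    (∀ ε : ℝ, 0 < ε →
      (fun X : ℝ => (CyclicCubic.countingFunction X : ℝ) - CyclicCubic.leadingConstant * X)
        =O[Filter.atTop] (fun X : ℝ => X ^ (2 / 3 + ε))) :=
  ⟨CyclicCubic.exists_embedsInCyclotomic,
    fun _ hs => ⟨CyclicCubic.multipliable_one_add_two_div hs,
      CyclicCubic.hasSum_one_div_conductor_cpow hs⟩,
    CyclicCubic.finite_setOf_conductor_le, CyclicCubic.multipliable_primeOneModThree,
    fun _ hε => CyclicCubic.isBigO_countingFunction_sub hε⟩
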